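/- Let $n\ge 0$. Work over $\mathbb C$. For a linear map $f:\mathbb C^n\to(\mathbb C^n)^*$ let $\mathsf G(f)=\{(v,f(v))\}\subseteq \mathbb C^n\oplus(\mathbb C^n)^*$ be its graph; $f$ is skew-symmetric if $f(v)(w)=-f(w)(v)$ for all $v,w$. Let $\mathrm{OG}(2n)$ be the irreducible component containing $\mathbb C^n\oplus 0$ of the variety of $n$-dimensional subspaces $U\subseteq\mathbb C^n\oplus(\mathbb C^n)^*$ on which the symmetric form $((v_1,\omega_1),(v_2,\omega_2))^+=\omega_1(v_2)+\omega_2(v_1)$ vanishes, and let $\mathrm{Fl}(n)$ be the variety of complete flags $E_1\subseteq\cdots\subseteq E_n=\mathbb C^n$. For $f$ and a flag $E_\bullet$, write $E_j\xrightarrow{f}E_i^*$ for the composition $E_j\hookrightarrow\mathbb C^n\xrightarrow{f}(\mathbb C^n)^*\twoheadrightarrow E_i^*$. Identify $w\in S_n$ with the permutation matrix with $1$'s in positions $(i,w(i))$, and let $w_{[i][j]}$ be its upper-left $i\times j$ corner. For an involution $y\in S_n$ let $$D^{\mathrm{Sp}}(y)=\{(i,j)\in[n]\times[n] : j<y(i),\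 i<y^{-1}(j),\ i>j\},$$ and for $D\subseteq\mathbb N\times\mathbb N$ let $\mathrm{Ess}(D)=\{(i,j)\in D : (i,j+1)\notin D,\ (i+1,j)\notin D\}$. Let $\overline{OGX}_y$ be the Zariski closure in $\mathrm{OG}(2n)\times\mathrm{Fl}(n)$ of $$\{(\mathsf G(f),E_\bullet) : f \text{ skew-symmetric},\ \operatorname{rank}(E_j\xrightarrow{f}E_i^*)=\operatorname{rank} y_{[i][j]}\text{ for all }(i,j)\in\mathrm{Ess}(D^{\mathrm{Sp}}(y))\}.$$ For a fixed-point-free involution $z$ let also $$OGX_z=\{(\mathsf G(f),E_\bullet) : f \text{ skew-symmetric and invertible},\ \operatorname{rank}(E_j\xrightarrow{f}E_i^*)=\operatorname{rank} z_{[i][j]}\text{ for all } i,j\in[n]\}.$$ If $z=(a_1,b_1)\cdots(a_r,b_r)$ is the disjoint cycle decomposition, with $a_i<b_i$, let $\mathsf{dearc}^{\mathrm R}(z)$ (respectively $\mathsf{dearc}^{\mathrm L}(z)$) be the product of the cycles $(a_i,b_i)$ over all $i$ such that $a_i<b_j<b_i$ for some $j$ (respectively $a_i<a_j<b_i$ for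 some $j$). **Theorem.** Let $z\in S_n$ be a fixed-point-free involution. Then $$\overline{OGX}_z=\overline{OGX}_{\mathsf{dearc}^{\mathrm L}(z)}=\overline{OGX}_{\mathsf{dearc}^{\mathrm R}(z)},$$ and this variety is also the Zariski closure of $OGX_z$ in $\mathrm{OG}(2n)\times\mathrm{Fl}(n)$. -/

import Mathlib

open Module

noncomputable section

namespace OrthGraph

/-! ## Linear algebra: `ℂⁿ ⊕ (ℂⁿ)*`, Grassmannian, flags -/

/-- The space `ℂⁿ`. -/
abbrev V (n : ℕ) : Type := Fin n → ℂ

/-- The space `ℂⁿ ⊕ (ℂⁿ)*`. -/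
abbrev W (n : ℕ) : Type := V n × Dual ℂ (V n)

/-- The Grassmannian `Gr(n, 2n)` of `n`-planes in `ℂⁿ ⊕ (ℂⁿ)*`. -/
@[ext] structure Gr (n : ℕ) where
  space : Submodule ℂ (W n)
  finrank_space : finrank ℂ space = n

/-- Complete flags `E₁ ⊆ E₂ ⊆ ⋯ ⊆ Eₙ = ℂⁿ`. Indices are shifted by one:
for `i : Fin n`, the subspace `E i` has dimension `i + 1`. -/
@[ext] structure Fl (n : ℕ) where
  E : Fin n → Submodule ℂ (V n)
  mono : Monotone E
  finrank_E : ∀ i, finrank ℂ (E i) = (i : ℕ) + 1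

/-- A point of `Gr(n, 2n) × Fl(n)`. A separate structure is used because the Zariski topology of
the product variety is not the product of the Zariski topologies. -/
@[ext] structure GrFl (n : ℕ) where
  U : Gr n
  flag : Fl n

/-- Ordered bases of points of `Gr(n, 2n)`. -/
abbrev GrFrame (n : ℕ) : Type := {u : Fin n → W n // LinearIndependent ℂ u}

/-- Ordered bases of `ℂⁿ`. -/
abbrev FlFrame (n : ℕ) : Type := {v : Fin n → V n // LinearIndependent ℂ v}

/-- The `n`-plane spanned by a frame. -/
def GrFrame.toGr {n : ℕ} (u : GrFrame n) : Gr n where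
  space := Submodule.span ℂ (Set.range u.1)
  finrank_space := by simpa using finrank_span_eq_card u.2

/-- The flag `E_i = ⟨v_1, …, v_i⟩` of an ordered basis. -/
def FlFrame.toFl {n : ℕ} (v : FlFrame n) : Fl n where
  E i := Submodule.span ℂ (Set.range fun k : Set.Iic i => v.1 k)
  mono := by
    intro i j hij
    apply Submodule.span_mono
    rintro _ ⟨k, rfl⟩
    exact ⟨⟨k.1, le_trans k.2 hij⟩, rfl⟩
  finrank_E i := by
    have h := finrank_span_eq_card
      (v.2.comp (fun k : Set.Iic i => (k : Fin n)) Subtype.val_injective)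
    have hc : Fintype.card (Set.Iic i) = (i : ℕ) + 1 := by simp
    exact h.trans hc

/-! ## Zariski topologies -/

/-- The (classical) Zariski topology on affine space `σ → ℂ`: the closed sets are the common zero
loci of sets of polynomials. -/
abbrev zariskiAffine (σ : Type) : TopologicalSpace (σ → ℂ) :=
  TopologicalSpace.induced (MvPolynomial.pointToPoint (k := ℂ) (σ := σ)) inferInstance

/-- The coordinates of the vectors of a frame in `ℂⁿ ⊕ (ℂⁿ)*` (an `n × 2n` matrix). -/
def GrFrame.coord {n : ℕ} (u : GrFrame n) : Fin n × (Fin n ⊕ Fin n) → ℂ :=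
  fun c => Sum.elim (fun i => (u.1 c.1).1 i) (fun i => (u.1 c.1).2 (Pi.single i 1)) c.2

/-- The coordinates of the vectors of a frame in `ℂⁿ` (an `n × n` matrix). -/
def FlFrame.coord {n : ℕ} (v : FlFrame n) : Fin n × Fin n → ℂ :=
  fun c => v.1 c.1 c.2

/-- The Zariski topology on `Gr(n, 2n)`, as the quotient of the variety of frames (full rank
`n × 2n` matrices) by the action of `GL(n)`. Frames form a Zariski locally trivial bundle over the
Grassmannian, so this agrees with the Zariski topology of the Plücker embedding. -/
instance (n : ℕ) : TopologicalSpace (Gr n) :=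
  TopologicalSpace.coinduced GrFrame.toGr
    (TopologicalSpace.induced GrFrame.coord (zariskiAffine _))

/-- The Zariski topology on the product variety `Gr(n, 2n) × Fl(n)`, again as the quotient of the
variety of pairs of frames, which is a Zariski locally trivial bundle over `Gr(n, 2n) × Fl(n)`. -/
instance (n : ℕ) : TopologicalSpace (GrFl n) :=
  TopologicalSpace.coinduced
    (fun p : GrFrame n × FlFrame n => (⟨p.1.toGr, p.2.toFl⟩ : GrFl n))
    (TopologicalSpace.induced
      (fun p : GrFrame n × FlFrame n => Sum.elim p.1.coord p.2.coord) (zariskiAffine _))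

/-! ## The orthogonal Grassmannian -/

/-- The symmetric form `((v₁, ω₁), (v₂, ω₂))⁺ = ω₁(v₂) + ω₂(v₁)`. -/
def formPlus {n : ℕ} (x y : W n) : ℂ := x.2 y.1 + y.2 x.1

/-- The variety of `U ∈ Gr(n, 2n)` with `(U, U)⁺ = 0`, with the subspace topology. -/
abbrev Isotropic (n : ℕ) : Type :=
  {U : Gr n // ∀ x ∈ U.space, ∀ y ∈ U.space, formPlus x y = 0}

/-- The isotropic subspace `ℂⁿ ⊕ 0`. -/
def isotropicBase (n : ℕ) : Isotropic n :=
  ⟨⟨LinearMap.range (LinearMap.inl ℂ (V n) (Dual ℂ (V n))), by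
      rw [LinearMap.finrank_range_of_inj LinearMap.inl_injective]; simp⟩, by
    rintro _ ⟨v, rfl⟩ _ ⟨w, rfl⟩
    simp [formPlus]⟩

/-- The orthogonal Grassmannian `OG(2n)`: the irreducible component containing `ℂⁿ ⊕ 0` of the
variety of `U` with `(U, U)⁺ = 0` (that point lies on exactly one irreducible component). -/
def OG (n : ℕ) : Set (Gr n) :=
  Subtype.val '' irreducibleComponent (isotropicBase n)

/-- The variety `OG(2n) × Fl(n)`, with the subspace topology from `Gr(n, 2n) × Fl(n)`. -/
abbrev OGFl (n : ℕ) : Type := {p : GrFl n // p.U ∈ OG n}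

/-! ## Diagrams and rank conditions

Rows, columns and flag indices are numbered from `0`, so that `i` stands for the index `i + 1`
of the usual conventions. -/

/-- The Rothe diagram `D(w) = {(i, j) ∈ [n] × [n] : j < w(i), i < w⁻¹(j)}`. -/
def rothe {n : ℕ} (w : Equiv.Perm (Fin n)) : Set (ℕ × ℕ) :=
  {c | ∃ i j : Fin n, c = ((i : ℕ), (j : ℕ)) ∧ j < w i ∧ i < w⁻¹ j}

/-- `D^Sp(y) = D(y) ∩ {(i, j) : i > j}`. -/
def rotheSp {n : ℕ} (y : Equiv.Perm (Fin n)) : Set (ℕ × ℕ) :=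
  rothe y ∩ {c | c.1 > c.2}

/-- The essential set of `D ⊆ ℕ × ℕ`. -/
def Ess (D : Set (ℕ × ℕ)) : Set (ℕ × ℕ) :=
  {c | c ∈ D ∧ (c.1, c.2 + 1) ∉ D ∧ (c.1 + 1, c.2) ∉ D}

/-- The rank of the upper-left corner, with rows `0, …, i` and columns `0, …, j`, of the
permutation matrix of `w` (which has its `1`s at the positions `(k, w k)`). -/
def cornerRank {n : ℕ} (w : Equiv.Perm (Fin n)) (i j : Fin n) : ℕ :=
  ((w.permMatrix ℂ).submatrix (fun k : Set.Iic i => (k : Fin n))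
    (fun k : Set.Iic j => (k : Fin n))).rank

/-- The rank of the composition `F ↪ ℂⁿ → (ℂⁿ)* ↠ E*`, the middle map being `f`. -/
def rankBetween {n : ℕ} (f : V n →ₗ[ℂ] Dual ℂ (V n)) (F E : Submodule ℂ (V n)) : ℕ :=
  finrank ℂ (LinearMap.range (E.subtype.dualMap ∘ₗ f ∘ₗ F.subtype))

/-- Skew-symmetric maps `ℂⁿ → (ℂⁿ)*`. -/
def IsSkew {n : ℕ} (f : V n →ₗ[ℂ] Dual ℂ (V n)) : Prop :=
  ∀ v w, f v w = -f w v

/-- `OGX_z`: pairs `(G(f), E)` with `f` skew-symmetric and invertible, and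
`rank (E_j → E_i*) = rank z_{[i][j]}` for all `i, j ∈ [n]`. -/
def OGX {n : ℕ} (z : Equiv.Perm (Fin n)) : Set (OGFl n) :=
  {p | ∃ f : V n →ₗ[ℂ] Dual ℂ (V n), IsSkew f ∧ Function.Bijective f ∧
    p.1.U.space = f.graph ∧
    ∀ i j : Fin n, rankBetween f (p.1.flag.E j) (p.1.flag.E i) = cornerRank z i j}

/-- Pairs `(G(f), E)` with `f` skew-symmetric (possibly singular) and
`rank (E_j → E_i*) = rank y_{[i][j]}` for all `(i, j) ∈ Ess(D^Sp(y))`. -/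
def OGXess {n : ℕ} (y : Equiv.Perm (Fin n)) : Set (OGFl n) :=
  {p | ∃ f : V n →ₗ[ℂ] Dual ℂ (V n), IsSkew f ∧
    p.1.U.space = f.graph ∧
    ∀ i j : Fin n, ((i : ℕ), (j : ℕ)) ∈ Ess (rotheSp y) →
      rankBetween f (p.1.flag.E j) (p.1.flag.E i) = cornerRank y i j}

/-! ## The dearc operations -/

/-- `(a, b)` with `a < b` is a 2-cycle of the involution `z`. -/
def IsArc {n : ℕ} (z : Equiv.Perm (Fin n)) (a b : Fin n) : Prop :=
  a < b ∧ z a = b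

open Classical in
/-- The product of the 2-cycles `(a, b)`, `a < b`, of the involution `z` such that `keep a b`. -/
def keepArcs {n : ℕ} (z : Equiv.Perm (Fin n)) (hz : Function.Involutive z)
    (keep : Fin n → Fin n → Prop) : Equiv.Perm (Fin n) :=
  Function.Involutive.toPerm
    (fun i => if keep (min i (z i)) (max i (z i)) then z i else i) (by
      intro i
      by_cases h : keep (min i (z i)) (max i (z i))
      · have h' : keep (min (z i) i) (max (z i) i) := by rwa [min_comm, max_comm]
        simp [h, hz i, h']
      · simp [h])

/-- `dearc^R(z)`: keep the arcs with the right endpoint of another arc underneath them. -/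
def dearcR {n : ℕ} (z : Equiv.Perm (Fin n)) (hz : Function.Involutive z) :
    Equiv.Perm (Fin n) :=
  keepArcs z hz fun a b => ∃ a' b', IsArc z a' b' ∧ a < b' ∧ b' < b

/-- `dearc^L(z)`: keep the arcs with the left endpoint of another arc underneath them. -/
def dearcL {n : ℕ} (z : Equiv.Perm (Fin n)) (hz : Function.Involutive z) :
    Equiv.Perm (Fin n) :=
  keepArcs z hz fun a b => ∃ a' b', IsArc z a' b' ∧ a < a' ∧ a' < b

end OrthGraph

end

noncomputable section

namespace OrthGraph

/-! ## Sums over upper-left corners -/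

section cornerSum

/-! In a basis adapted to the flag, a point `(G(f), E)` with `f` skew becomes a skew-symmetric
matrix `A`, and the ranks of the maps `E_j → E_i*` become the ranks of its upper-left corners. These
ranks do not change under `A ↦ g A gᵀ` with `g` lower unitriangular, and every such orbit contains a
monomial matrix (`exists_isMono`). The corner ranks of `A` are therefore the corner sums of a
partial matching `ι`, and each claim reduces to `closure (OGX z) = closure (OGXess y)`, with `y` one
of `z`, `dearcL z`, `dearcR z` (`closure_OGX_eq`).

For `⊆`, the corner sums of `y` and `z` agree on the essential set of `y`. For `⊇`, there are two
ingredients.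

Combinatorics: bounds by `y` on its essential set force `ι ≤ z` at every corner. A bound spreads
from the essential set to the diagram, and from the diagram to all corners
(`le_on_rotheSp_of_le_on_ess`, `le_of_le_on_rotheSp`). No conditions are imposed on the diagonal
because corner sums there are even. The map `dearcL` preserves the diagram and the corner sums on
it. The map `dearcR` changes the diagram, and parity recovers the missing bounds
(`le_on_rotheSp_of_dearcR`).

Degeneration: if `ι ≤ z` and `ι ≠ z`, some exchange of partners strictly increases `ι` while staying
below `z` (`exists_swapMatching_le`). Adding a small pivot `t` to a monomial matrix realizes this
exchange (`IsMono.cornerRk_add_skewUnit`). Letting `t → 0` and inducting, `A` is a Euclidean limit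
of matrices with exactly the corner ranks of `z` (`mem_closure_rankLocus`). Zariski closed
conditions are polynomial, hence closed under such limits. -/

/-- The sum of the entries of `ι` in rows `k < p` and columns `l < q`. -/
def cornerSum {n : ℕ} (ι : Fin n → Fin n → ℤ) (p q : ℕ) : ℤ :=
  ∑ k : Fin n, ∑ l : Fin n, if (k : ℕ) < p ∧ (l : ℕ) < q then ι k l else 0

/-- The entries of the permutation matrix of `w`. -/
def permInd {n : ℕ} (w : Equiv.Perm (Fin n)) (k l : Fin n) : ℤ := if w k = l then 1 else 0

/-- Integral matrices of partial matchings. -/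
structure IsMatching {n : ℕ} (ι : Fin n → Fin n → ℤ) : Prop where
  nonneg : ∀ k l, 0 ≤ ι k l
  symm : ∀ k l, ι k l = ι l k
  diag : ∀ k, ι k k = 0
  row : ∀ k, ∑ l, ι k l ≤ 1

variable {n : ℕ} {ι : Fin n → Fin n → ℤ}

lemma cornerSum_symm (h : ∀ k l, ι k l = ι l k) (p q : ℕ) :
    cornerSum ι p q = cornerSum ι q p := by
  unfold cornerSum
  rw [Finset.sum_comm]
  refine Finset.sum_congr rfl fun k _ => Finset.sum_congr rfl fun l _ => ?_
  rw [h l k]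
  simp only [and_comm]

lemma cornerSum_mono (h : ∀ k l, 0 ≤ ι k l) {p p' q q' : ℕ} (hp : p ≤ p') (hq : q ≤ q') :
    cornerSum ι p q ≤ cornerSum ι p' q' := by
  unfold cornerSum
  refine Finset.sum_le_sum fun k _ => Finset.sum_le_sum fun l _ => ?_
  have := h k l
  split_ifs <;> omega

@[simp] lemma cornerSum_zero_left (q : ℕ) : cornerSum ι 0 q = 0 := by
  simp [cornerSum]

@[simp] lemma cornerSum_zero_right (p : ℕ) : cornerSum ι p 0 = 0 := by
  simp [cornerSum]

lemma cornerSum_succ (i : Fin n) (q : ℕ) :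
    cornerSum ι (i + 1) q = cornerSum ι i q + ∑ l : Fin n, if (l : ℕ) < q then ι i l else 0 := by
  unfold cornerSum
  have : ∀ k : Fin n, (∑ l : Fin n, if (k : ℕ) < i + 1 ∧ (l : ℕ) < q then ι k l else 0) =
      (∑ l : Fin n, if (k : ℕ) < i ∧ (l : ℕ) < q then ι k l else 0) +
      if k = i then (∑ l : Fin n, if (l : ℕ) < q then ι i l else 0) else 0 := by
    intro k
    by_cases hk : k = i
    · subst hk; simp
    · have : (k : ℕ) ≠ i := fun h => hk (Fin.ext h)
      have h2 : (k : ℕ) < i + 1 ↔ (k : ℕ) < i := by omega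
      simp [hk, h2]
  rw [Finset.sum_congr rfl fun k _ => this k, Finset.sum_add_distrib]
  simp

lemma cornerSum_succ_of_le {p : ℕ} (hp : n ≤ p) (q : ℕ) :
    cornerSum ι (p + 1) q = cornerSum ι p q := by
  unfold cornerSum
  refine Finset.sum_congr rfl fun k _ => Finset.sum_congr rfl fun l _ => ?_
  have := k.2
  have h1 : (k : ℕ) < p + 1 := by omega
  have h2 : (k : ℕ) < p := by omega
  simp [h1, h2]

lemma IsMatching.succ_le (h : IsMatching ι) (p q : ℕ) :
    cornerSum ι (p + 1) q ≤ cornerSum ι p q + 1 := by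
  rcases lt_or_ge p n with hp | hp
  · rw [cornerSum_succ ⟨p, hp⟩ q]
    have : (∑ l : Fin n, if (l : ℕ) < q then ι ⟨p, hp⟩ l else 0) ≤ ∑ l, ι ⟨p, hp⟩ l := by
      refine Finset.sum_le_sum fun l _ => ?_
      have := h.nonneg ⟨p, hp⟩ l
      split_ifs <;> omega
    have := h.row ⟨p, hp⟩
    simp only at *
    omega
  · rw [cornerSum_succ_of_le hp]; omega

lemma IsMatching.succ_le_right (h : IsMatching ι) (p q : ℕ) :
    cornerSum ι p (q + 1) ≤ cornerSum ι p q + 1 := by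
  rw [cornerSum_symm h.symm p (q + 1), cornerSum_symm h.symm p q]
  exact h.succ_le q p

/-- Modulo 2 the entries at `(k, l)` and `(l, k)` cancel, and the diagonal is zero. This parity
replaces the rank conditions on the diagonal, which the diagram `rotheSp` leaves out. -/
lemma IsMatching.even_diag (h : IsMatching ι) (p : ℕ) : Even (cornerSum ι p p) := by
  rw [even_iff_two_dvd, ← Int.modEq_zero_iff_dvd]
  apply (ZMod.intCast_eq_intCast_iff _ _ 2).1
  unfold cornerSum
  rw [← Fintype.sum_prod_type']
  push_cast
  refine Finset.sum_involution (fun x _ => (x.2, x.1)) ?_ ?_ (by simp) (by simp)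
  · rintro ⟨k, l⟩ -
    simp only [and_comm, h.symm l k]
    exact CharTwo.add_self_eq_zero _
  · rintro ⟨k, l⟩ - hne heq
    obtain rfl : k = l := by simpa [eq_comm] using congrArg Prod.fst heq
    simp [h.diag] at hne

/-! ## Corner sums of permutations -/

lemma permInd_symm {w : Equiv.Perm (Fin n)} (hw : Function.Involutive w) (k l : Fin n) :
    permInd w k l = permInd w l k := by
  unfold permInd
  have : w k = l ↔ w l = k := ⟨fun h => by rw [← h, hw], fun h => by rw [← h, hw]⟩
  simp [this]

lemma permInd_nonneg (w : Equiv.Perm (Fin n)) (k l : Fin n) : 0 ≤ permInd w k l := by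
  unfold permInd; split_ifs <;> simp

lemma permInd_isMatching {z : Equiv.Perm (Fin n)} (hz : Function.Involutive z)
    (hfpf : ∀ i, z i ≠ i) : IsMatching (permInd z) where
  nonneg := permInd_nonneg z
  symm := permInd_symm hz
  diag k := by simp [permInd, hfpf]
  row k := by simp [permInd]

lemma cornerSum_permInd (w : Equiv.Perm (Fin n)) (p q : ℕ) :
    cornerSum (permInd w) p q = ∑ k : Fin n, if (k : ℕ) < p ∧ (w k : ℕ) < q then 1 else 0 := by
  unfold cornerSum permInd
  refine Finset.sum_congr rfl fun k _ => ?_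
  rw [Finset.sum_eq_single (w k)]
  · simp
  · intro l _ hl; simp [hl.symm]
  · simp

lemma cornerSum_permInd_succ (w : Equiv.Perm (Fin n)) (i : Fin n) (q : ℕ) :
    cornerSum (permInd w) (i + 1) q =
      cornerSum (permInd w) i q + if (w i : ℕ) < q then 1 else 0 := by
  rw [cornerSum_succ]
  congr 1
  unfold permInd
  rw [Finset.sum_eq_single (w i)]
  · simp
  · intro l _ hl; simp [hl.symm]
  · simp

lemma cornerSum_permInd_succ_right {w : Equiv.Perm (Fin n)} (hw : Function.Involutive w)
    (p : ℕ) (j : Fin n) :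
    cornerSum (permInd w) p (j + 1) =
      cornerSum (permInd w) p j + if (w j : ℕ) < p then 1 else 0 := by
  rw [cornerSum_symm (permInd_symm hw), cornerSum_permInd_succ,
    cornerSum_symm (permInd_symm hw) p j]

/-! ## Essential sets -/

lemma mem_rotheSp {w : Equiv.Perm (Fin n)} (hw : Function.Involutive w) {i j : Fin n} :
    ((i : ℕ), (j : ℕ)) ∈ rotheSp w ↔ j < w i ∧ i < w j ∧ j < i := by
  have hinv : w⁻¹ j = w j := by rw [Equiv.Perm.inv_eq_iff_eq, hw]
  unfold rotheSp rothe
  constructor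
  · rintro ⟨⟨i', j', h, h1, h2⟩, h3⟩
    simp only [Prod.mk.injEq, Fin.val_inj] at h
    obtain ⟨rfl, rfl⟩ := h
    exact ⟨h1, hinv ▸ h2, h3⟩
  · rintro ⟨h1, h2, h3⟩
    exact ⟨⟨i, j, rfl, h1, hinv.symm ▸ h2⟩, h3⟩

lemma exists_fin_of_mem_rotheSp {w : Equiv.Perm (Fin n)} {c : ℕ × ℕ} (h : c ∈ rotheSp w) :
    ∃ i j : Fin n, c = ((i : ℕ), (j : ℕ)) := by
  obtain ⟨⟨i, j, h, -⟩, -⟩ := h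
  exact ⟨i, j, h⟩

/-- From a non-essential cell one can step right or down inside the diagram. Such a step leaves the
corner sum of `y` unchanged and cannot decrease that of `ι`, so the bound travels backwards. The
number `m` bounds the remaining room `2 * n - (i + j)`. -/
lemma le_on_rotheSp_of_le_on_ess {y : Equiv.Perm (Fin n)} (hy : Function.Involutive y)
    (hι : ∀ k l, 0 ≤ ι k l)
    (h : ∀ i j : Fin n, ((i : ℕ), (j : ℕ)) ∈ Ess (rotheSp y) →
      cornerSum ι (i + 1) (j + 1) ≤ cornerSum (permInd y) (i + 1) (j + 1)) :
    ∀ (m : ℕ) (i j : Fin n), 2 * n ≤ i + j + m → ((i : ℕ), (j : ℕ)) ∈ rotheSp y →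
      cornerSum ι (i + 1) (j + 1) ≤ cornerSum (permInd y) (i + 1) (j + 1) := by
  intro m
  induction m with
  | zero => intro i j hm; omega
  | succ m ih =>
    intro i j hm hij
    by_cases h1 : ((i : ℕ), (j : ℕ) + 1) ∈ rotheSp y
    · obtain ⟨i', j', he⟩ := exists_fin_of_mem_rotheSp h1
      simp only [Prod.mk.injEq, Fin.val_inj] at he
      obtain ⟨rfl, he⟩ := he
      rw [he] at h1
      have := ih i j' (by omega) h1
      rw [cornerSum_permInd_succ_right hy, ← he] at this
      have h2 : ¬ ((y j' : ℕ) < i + 1) := by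
        have := ((mem_rotheSp hy).1 h1).2.1
        omega
      simp only [h2, if_false] at this
      have h3 := cornerSum_mono hι (le_refl ((i : ℕ) + 1)) (Nat.le_succ ((j : ℕ) + 1))
      simp only [Nat.succ_eq_add_one] at h3
      omega
    by_cases h2 : ((i : ℕ) + 1, (j : ℕ)) ∈ rotheSp y
    · obtain ⟨i', j', he⟩ := exists_fin_of_mem_rotheSp h2
      simp only [Prod.mk.injEq, Fin.val_inj] at he
      obtain ⟨he, rfl⟩ := he
      rw [he] at h2
      have := ih i' j (by omega) h2
      rw [cornerSum_permInd_succ, ← he] at this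
      have h2 : ¬ ((y i' : ℕ) < j + 1) := by
        have := ((mem_rotheSp hy).1 h2).1
        omega
      simp only [h2, if_false] at this
      have h3 := cornerSum_mono hι (Nat.le_succ ((i : ℕ) + 1)) (le_refl ((j : ℕ) + 1))
      simp only [Nat.succ_eq_add_one] at h3
      omega
    exact h i j ⟨hij, h1, h2⟩

/-- At a corner outside the diagram, removing a suitable last row or column lowers the sum of `z` by
one, and lowers that of `ι` by at most one. The only exception is a diagonal corner, where parity
decides. -/
lemma le_of_le_on_rotheSp {z : Equiv.Perm (Fin n)} (hz : Function.Involutive z)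
    (hfpf : ∀ i, z i ≠ i) (hι : IsMatching ι)
    (h : ∀ i j : Fin n, ((i : ℕ), (j : ℕ)) ∈ rotheSp z →
      cornerSum ι (i + 1) (j + 1) ≤ cornerSum (permInd z) (i + 1) (j + 1)) :
    ∀ (m p q : ℕ), p + q ≤ m → cornerSum ι p q ≤ cornerSum (permInd z) p q := by
  intro m
  have hzm := permInd_isMatching hz hfpf
  induction m with
  | zero =>
    intro p q hpq
    obtain rfl : p = 0 := by omega
    simp
  | succ m ih =>
    intro p q hpq
    wlog hqp : q ≤ p generalizing p q
    · rw [cornerSum_symm hι.symm, cornerSum_symm hzm.symm]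
      exact this q p (by omega) (by omega)
    rcases q with _ | j
    · simp
    obtain ⟨i, rfl⟩ : ∃ i, p = i + 1 := ⟨p - 1, by omega⟩
    rcases le_or_gt n i with hi | hi
    · rw [cornerSum_succ_of_le hi, cornerSum_succ_of_le hi]
      exact ih _ _ (by omega)
    obtain ⟨i, rfl⟩ : ∃ i' : Fin n, i = i' := ⟨⟨i, hi⟩, rfl⟩
    obtain ⟨j, rfl⟩ : ∃ j' : Fin n, j = j' := ⟨⟨j, by omega⟩, rfl⟩
    by_cases h1 : (z i : ℕ) < j + 1
    · have h2 := cornerSum_permInd_succ z i (j + 1)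
      rw [if_pos h1] at h2
      have := hι.succ_le i (j + 1)
      have := ih i (j + 1) (by omega)
      omega
    have h2 := cornerSum_permInd_succ_right hz (i + 1) j
    have h3 := hι.succ_le_right (i + 1) j
    have h4 := ih (i + 1) j (by omega)
    by_cases h5 : (z j : ℕ) < i + 1
    · rw [if_pos h5] at h2
      omega
    rw [if_neg h5] at h2
    rcases eq_or_ne i j with rfl | hij
    -- Removing a column only gives an excess of at most one; two even numbers cannot differ by
    -- exactly one.
    · obtain ⟨u, hu⟩ := hι.even_diag (i + 1)
      obtain ⟨v, hv⟩ := hzm.even_diag (i + 1)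
      omega
    · refine h i j ((mem_rotheSp hz).2 ⟨?_, ?_, ?_⟩)
      · exact Fin.lt_def.2 (by omega)
      · exact Fin.lt_def.2 (by omega)
      · have : (i : ℕ) ≠ j := fun h => hij (Fin.ext h)
        exact Fin.lt_def.2 (by omega)

/-! ## Removing arcs -/

lemma keepArcs_involutive {z : Equiv.Perm (Fin n)} (hz : Function.Involutive z)
    (keep : Fin n → Fin n → Prop) : Function.Involutive (keepArcs z hz keep) :=
  Function.Involutive.toPerm_involutive _

lemma keepArcs_eq_or {z : Equiv.Perm (Fin n)} (hz : Function.Involutive z)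
    (keep : Fin n → Fin n → Prop) (k : Fin n) :
    keepArcs z hz keep k = z k ∨ keepArcs z hz keep k = k := by
  classical
  change (if keep (min k (z k)) (max k (z k)) then z k else k) = _ ∨
    (if keep (min k (z k)) (max k (z k)) then z k else k) = _
  split_ifs <;> simp

lemma keepArcs_eq_iff {z : Equiv.Perm (Fin n)} (hz : Function.Involutive z)
    (keep : Fin n → Fin n → Prop) {k : Fin n} (hk : k < z k) :
    keepArcs z hz keep k = z k ↔ keep k (z k) := by
  classical
  change (if keep (min k (z k)) (max k (z k)) then z k else k) = _ ↔ _
  rw [min_eq_left hk.le, max_eq_right hk.le]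
  split_ifs with h
  · simp [h]
  · simp [h, hk.ne]

lemma keepArcs_apply_eq {z : Equiv.Perm (Fin n)} (hz : Function.Involutive z)
    (keep : Fin n → Fin n → Prop) {k : Fin n} :
    keepArcs z hz keep (z k) = k ↔ keepArcs z hz keep k = z k := by
  constructor
  · intro h; rw [← h, keepArcs_involutive hz keep, h]
  · intro h; rw [← h, keepArcs_involutive hz keep]

/-- The corner sums of `z` and of `keepArcs z` agree at `(i, j)`, `j ≤ i`, if no removed arc
starts weakly before `j` and ends after `i`. -/
lemma cornerSum_keepArcs {z : Equiv.Perm (Fin n)} (hz : Function.Involutive z)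
    (keep : Fin n → Fin n → Prop) {i j : Fin n} (hij : j ≤ i)
    (h : ∀ k ≤ j, i < z k → keepArcs z hz keep k = z k) :
    cornerSum (permInd (keepArcs z hz keep)) (i + 1) (j + 1) =
      cornerSum (permInd z) (i + 1) (j + 1) := by
  rw [cornerSum_symm (permInd_symm (keepArcs_involutive hz keep)),
    cornerSum_symm (permInd_symm hz), cornerSum_permInd, cornerSum_permInd]
  refine Finset.sum_congr rfl fun k _ => ?_
  have := h k
  have h2 := keepArcs_eq_or hz keep k
  by_cases hk : k ≤ j
  · by_cases hk2 : i < z k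
    · rw [this hk hk2]
    · have : (keepArcs z hz keep k : ℕ) < i + 1 ↔ (z k : ℕ) < i + 1 := by
        rcases h2 with h2 | h2 <;> rw [h2]
        rw [Fin.le_def] at *
        rw [Fin.lt_def] at hk2
        omega
      simp [this]
  · have : ¬ ((k : ℕ) < j + 1) := by rw [Fin.le_def] at hk; omega
    simp [this]

/-! ### Diagrams and corner sums of `dearcL` and `dearcR` -/

section dearc

variable {z : Equiv.Perm (Fin n)} (hz : Function.Involutive z) (hfpf : ∀ i, z i ≠ i)
include hfpf

/-- An arc is removed by `dearcL` only if no left endpoint lies under it, so every point under it is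
a right endpoint. -/
lemma apply_lt_of_dearcL {k x : Fin n} (hk : k < z k) (h : dearcL z hz k ≠ z k)
    (h1 : k < x) (h2 : x < z k) : z x < x := by
  by_contra h3
  have h4 : x < z x := lt_of_le_of_ne (not_lt.1 h3) (hfpf x).symm
  exact h ((keepArcs_eq_iff hz _ hk).2 ⟨x, z x, ⟨h4, rfl⟩, h1, h2⟩)

lemma lt_apply_of_dearcR {k x : Fin n} (hk : k < z k) (h : dearcR z hz k ≠ z k)
    (h1 : k < x) (h2 : x < z k) : x < z x := by
  by_contra h3
  have h4 : z x < x := lt_of_le_of_ne (not_lt.1 h3) (hfpf x)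
  exact h ((keepArcs_eq_iff hz _ hk).2 ⟨z x, x, ⟨h4, hz x⟩, h1, h2⟩)

/-- Points under an arc removed by `dearcR` are all left endpoints. The partner of such a point is a
right endpoint, so it cannot also lie under the arc and must be beyond its right end. -/
lemma apply_lt_apply_of_dearcR {k x : Fin n} (hk : k < z k) (h : dearcR z hz k ≠ z k)
    (h1 : k < x) (h2 : x < z k) : z k < z x := by
  have h3 := lt_apply_of_dearcR hz hfpf hk h h1 h2
  by_contra h4
  have h5 : z x ≠ z k := fun h => h1.ne' (z.injective h)
  have h6 := lt_apply_of_dearcR hz hfpf hk h (h1.trans h3) (lt_of_le_of_ne (not_lt.1 h4) h5)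
  rw [hz x] at h6
  exact lt_asymm h3 h6

lemma rotheSp_dearcL : rotheSp (dearcL z hz) = rotheSp z := by
  have hy := keepArcs_involutive hz (fun a b => ∃ a' b', IsArc z a' b' ∧ a < a' ∧ a' < b)
  change Function.Involutive (dearcL z hz) at hy
  have hor : ∀ k, dearcL z hz k = z k ∨ dearcL z hz k = k := keepArcs_eq_or hz _
  have happ : ∀ k, dearcL z hz (z k) = k ↔ dearcL z hz k = z k :=
    fun k => keepArcs_apply_eq hz _
  ext c
  constructor
  · intro hc
    obtain ⟨i, j, rfl⟩ := exists_fin_of_mem_rotheSp hc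
    rw [mem_rotheSp hy] at hc
    rw [mem_rotheSp hz]
    obtain ⟨h1, h2, h3⟩ := hc
    have hj : dearcL z hz j = z j := by
      rcases hor j with h | h
      · exact h
      · rw [h] at h2; exact absurd h2 h3.not_gt
    rw [hj] at h2
    refine ⟨?_, h2, h3⟩
    rcases hor i with h | h
    · rwa [h] at h1
    · by_contra h4
      have h5 : z i ≠ j := by rintro rfl; rw [hz] at h2; exact lt_irrefl _ h2
      have h6 : z i < j := lt_of_le_of_ne (not_lt.1 h4) h5
      have h7 : dearcL z hz (z i) ≠ z (z i) := by
        rw [hz, Ne, happ, h]; exact (hfpf i).symm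
      have := apply_lt_of_dearcL hz hfpf (k := z i) (x := j) (by rw [hz]; exact h6.trans h3) h7
        h6 (by rwa [hz])
      exact lt_asymm this (h3.trans h2)
  · intro hc
    obtain ⟨i, j, rfl⟩ := exists_fin_of_mem_rotheSp hc
    rw [mem_rotheSp hz] at hc
    rw [mem_rotheSp hy]
    obtain ⟨h1, h2, h3⟩ := hc
    -- If the arc at `j` were removed, both `i` and `z i` would lie under it and be right endpoints,
    -- although they are partners.
    have hj : dearcL z hz j = z j := by
      by_contra h
      have h4 := apply_lt_of_dearcL hz hfpf (h3.trans h2) h h3 h2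
      have h5 := apply_lt_of_dearcL hz hfpf (h3.trans h2) h h1 (h4.trans h2)
      rw [hz] at h5
      exact lt_asymm h4 h5
    refine ⟨?_, hj ▸ h2, h3⟩
    rcases hor i with h | h <;> rw [h] <;> assumption

lemma cornerSum_dearcL {i j : Fin n} (h : ((i : ℕ), (j : ℕ)) ∈ rotheSp z) :
    cornerSum (permInd (dearcL z hz)) (i + 1) (j + 1) =
      cornerSum (permInd z) (i + 1) (j + 1) := by
  have h' := h
  have hy : Function.Involutive (dearcL z hz) := keepArcs_involutive hz _
  rw [← rotheSp_dearcL hz hfpf, mem_rotheSp hy] at h'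
  rw [mem_rotheSp hz] at h
  refine cornerSum_keepArcs hz _ h.2.2.le fun k hk hik => ?_
  by_contra h2
  have hk2 : k < z k := (hk.trans h.2.2.le).trans_lt hik
  rcases hk.lt_or_eq with hk | rfl
  · exact lt_asymm (apply_lt_of_dearcL hz hfpf hk2 h2 hk (h.2.2.trans hik)) (h.2.2.trans h.2.1)
  · rcases keepArcs_eq_or hz (fun a b => ∃ a' b', IsArc z a' b' ∧ a < a' ∧ a' < b) k with h3 | h3
    · exact h2 h3
    · change dearcL z hz k = k at h3
      exact absurd h'.2.1 (by rw [h3]; exact h.2.2.not_gt)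

/-- A removed arc straddling the cell `(i, j)` would put `(i + 1, j)` in the diagram as well,
contradicting essentiality. The equality can fail at other cells of the diagram. -/
lemma cornerSum_dearcR_of_ess {i j : Fin n}
    (h : ((i : ℕ), (j : ℕ)) ∈ Ess (rotheSp (dearcR z hz))) :
    cornerSum (permInd (dearcR z hz)) (i + 1) (j + 1) =
      cornerSum (permInd z) (i + 1) (j + 1) := by
  have hy : Function.Involutive (dearcR z hz) := keepArcs_involutive hz _
  have hor : ∀ k, dearcR z hz k = z k ∨ dearcR z hz k = k := keepArcs_eq_or hz _
  have happ : ∀ k, dearcR z hz (z k) = k ↔ dearcR z hz k = z k :=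
    fun k => keepArcs_apply_eq hz _
  obtain ⟨h0, -, hdown⟩ := h
  rw [mem_rotheSp hy] at h0
  obtain ⟨h1, h2, h3⟩ := h0
  refine cornerSum_keepArcs hz _ h3.le fun k hk hik => ?_
  by_contra hkeep
  change dearcR z hz k ≠ z k at hkeep
  have hk2 : k < z k := (hk.trans h3.le).trans_lt hik
  have hjk : k ≠ j := by
    rintro rfl
    rcases hor k with h | h
    · exact hkeep h
    · rw [h] at h2; exact lt_asymm h2 h3
  have hkj : k < j := lt_of_le_of_ne hk hjk
  have hj1 : dearcR z hz j = z j := by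
    rcases hor j with h | h
    · exact h
    · rw [h] at h2; exact absurd h2 h3.not_gt
  have hzj := apply_lt_apply_of_dearcR hz hfpf hk2 hkeep hkj (h3.trans hik)
  obtain ⟨i', hi'⟩ : ∃ i' : Fin n, (i' : ℕ) = i + 1 := by
    have := (z k).2
    exact ⟨⟨i + 1, by rw [Fin.lt_def] at hik; omega⟩, rfl⟩
  apply hdown
  change ((i : ℕ) + 1, (j : ℕ)) ∈ _
  rw [← hi', mem_rotheSp hy]
  have hi'k : i' ≤ z k := by rw [Fin.le_def, hi']; exact hik
  have hji' : j < i' := by rw [Fin.lt_def, hi']; rw [Fin.lt_def] at h3; omega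
  refine ⟨?_, by rw [hj1]; exact hi'k.trans_lt hzj, hji'⟩
  rcases hor i' with h | h
  · rcases hi'k.lt_or_eq with h4 | h4
    · rw [h]
      exact (h3.trans hik).trans (apply_lt_apply_of_dearcR hz hfpf hk2 hkeep (hkj.trans hji') h4)
    · rw [h4, hz, happ] at h
      exact absurd h hkeep
  · rwa [h]

lemma le_on_rotheSp_of_dearcR (hι : IsMatching ι)
    (h : ∀ i j : Fin n, ((i : ℕ), (j : ℕ)) ∈ Ess (rotheSp (dearcR z hz)) →
      cornerSum ι (i + 1) (j + 1) ≤ cornerSum (permInd (dearcR z hz)) (i + 1) (j + 1))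
    {i j : Fin n} (hij : ((i : ℕ), (j : ℕ)) ∈ rotheSp z) :
    cornerSum ι (i + 1) (j + 1) ≤ cornerSum (permInd z) (i + 1) (j + 1) := by
  have hy : Function.Involutive (dearcR z hz) := keepArcs_involutive hz _
  have hor : ∀ k, dearcR z hz k = z k ∨ dearcR z hz k = k := keepArcs_eq_or hz _
  have happ : ∀ k, dearcR z hz (z k) = k ↔ dearcR z hz k = z k :=
    fun k => keepArcs_apply_eq hz _
  have hD := fun i j => le_on_rotheSp_of_le_on_ess hy hι.nonneg h (2 * n) i j (by omega)
  rw [mem_rotheSp hz] at hij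
  obtain ⟨h1, h2, h3⟩ := hij
  -- If a removed arc `(a, z a)` straddles the cell, the bound comes from the cell `(z a, z a - 1)`
  -- of the new diagram. Parity turns it into a bound at the diagonal corner just before `z a`,
  -- which dominates the corner at `(i, j)`.
  by_cases hrem : ∃ a ≤ j, i < z a ∧ dearcR z hz a ≠ z a
  · obtain ⟨a, haj, hia, hne⟩ := hrem
    have haz : a < z a := (haj.trans h3.le).trans_lt hia
    -- the index just before the right end of the removed arc
    obtain ⟨e, he⟩ : ∃ e : Fin n, (e : ℕ) + 1 = z a := by
      refine ⟨⟨z a - 1, by omega⟩, ?_⟩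
      rw [Fin.lt_def] at hia
      simp only
      omega
    have hie : i ≤ e := by rw [Fin.le_def]; rw [Fin.lt_def] at hia; omega
    have hez : e < z a := by rw [Fin.lt_def]; omega
    have hae : a < e := (haj.trans_lt h3).trans_le hie
    have hze := apply_lt_apply_of_dearcR hz hfpf haz hne hae hez
    have hye : dearcR z hz e = z e :=
      (keepArcs_eq_iff hz _ (hez.trans hze)).2 ⟨a, z a, ⟨haz, rfl⟩, hez, hze⟩
    have hyb : dearcR z hz (z a) = z a := by
      rcases hor (z a) with h | h
      · rw [hz, happ] at h; exact absurd h hne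
      · exact h
    have hmem : ((z a : ℕ), (e : ℕ)) ∈ rotheSp (dearcR z hz) := by
      rw [mem_rotheSp hy, hyb, hye]; exact ⟨hez, hze, hez⟩
    have hle := hD _ _ hmem
    -- Any arc straddling this cell has the right endpoint `z a` under it, so it is kept.
    have heq : cornerSum (permInd (dearcR z hz)) (z a + 1) (e + 1) =
        cornerSum (permInd z) (z a + 1) (e + 1) := by
      refine cornerSum_keepArcs hz _ hez.le fun k hk hak => ?_
      exact (keepArcs_eq_iff hz _ ((hk.trans_lt hez).trans hak)).2
        ⟨a, z a, ⟨haz, rfl⟩, hk.trans_lt hez, hak⟩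
    rw [heq, cornerSum_permInd_succ, hz, if_pos (by rw [Fin.lt_def] at hae; omega), ← he] at hle
    have hle2 := cornerSum_mono hι.nonneg (Nat.le_succ ((e : ℕ) + 1)) (le_refl ((e : ℕ) + 1))
    simp only [Nat.succ_eq_add_one] at hle2
    obtain ⟨u, hu⟩ := hι.even_diag (e + 1)
    obtain ⟨v, hv⟩ := (permInd_isMatching hz hfpf).even_diag (e + 1)
    have hle3 : cornerSum ι (i + 1) (j + 1) ≤ cornerSum ι (e + 1) (e + 1) :=
      cornerSum_mono hι.nonneg (by rw [Fin.le_def] at hie; omega)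
        (by rw [Fin.le_def] at hie; rw [Fin.lt_def] at h3; omega)
    -- Points from `a` to `e` are matched beyond `e`, so the arcs of `z` inside the larger corner
    -- only use points before `a ≤ j`.
    have hle4 : cornerSum (permInd z) (e + 1) (e + 1) ≤
        cornerSum (permInd z) (i + 1) (j + 1) := by
      have hout : ∀ k, a ≤ k → k ≤ e → e < z k := by
        intro k hk hke
        rcases hk.lt_or_eq with hk | rfl
        · exact hez.trans
            (apply_lt_apply_of_dearcR hz hfpf haz hne hk (hke.trans_lt hez))
        · exact hez
      rw [cornerSum_permInd, cornerSum_permInd]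
      refine Finset.sum_le_sum fun k _ => ?_
      by_cases hk : (k : ℕ) < e + 1 ∧ (z k : ℕ) < e + 1
      · rw [if_pos hk, if_pos]
        have hka : k < a := by
          by_contra hka
          have := hout k (not_lt.1 hka) (Fin.le_def.2 (by omega))
          rw [Fin.lt_def] at this
          omega
        have hzka : z k < a := by
          by_contra hka
          have := hout (z k) (not_lt.1 hka) (Fin.le_def.2 (by omega))
          rw [Fin.lt_def, hz] at this
          omega
        rw [Fin.lt_def] at hka hzka h3
        rw [Fin.le_def] at haj
        omega
      · rw [if_neg hk]
        split_ifs <;> simp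
    omega
  · push Not at hrem
    have hj1 := hrem j le_rfl h2
    rw [← cornerSum_keepArcs hz _ h3.le hrem]
    refine hD i j ((mem_rotheSp hy).2 ⟨?_, hj1 ▸ h2, h3⟩)
    rcases hor i with h | h <;> rw [h] <;> assumption

end dearc

end cornerSum

/-! ## Swapping the partners in a matching -/

section swap

variable {n : ℕ} {ι : Fin n → Fin n → ℤ}

/-- The sum of the entries of `u` with index `k < p`. -/
def partialSum (u : Fin n → ℤ) (p : ℕ) : ℤ := ∑ k : Fin n, if (k : ℕ) < p then u k else 0

lemma cornerSum_add (ι κ : Fin n → Fin n → ℤ) (p q : ℕ) :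
    cornerSum (fun k l => ι k l + κ k l) p q = cornerSum ι p q + cornerSum κ p q := by
  unfold cornerSum
  simp only [← Finset.sum_add_distrib]
  refine Finset.sum_congr rfl fun k _ => Finset.sum_congr rfl fun l _ => ?_
  split_ifs <;> simp

lemma cornerSum_sub (ι κ : Fin n → Fin n → ℤ) (p q : ℕ) :
    cornerSum (fun k l => ι k l - κ k l) p q = cornerSum ι p q - cornerSum κ p q := by
  unfold cornerSum
  simp only [← Finset.sum_sub_distrib]
  refine Finset.sum_congr rfl fun k _ => Finset.sum_congr rfl fun l _ => ?_
  split_ifs <;> simp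

lemma cornerSum_mul (u v : Fin n → ℤ) (p q : ℕ) :
    cornerSum (fun k l => u k * v l) p q = partialSum u p * partialSum v q := by
  unfold cornerSum partialSum
  rw [Finset.sum_mul_sum]
  refine Finset.sum_congr rfl fun k _ => Finset.sum_congr rfl fun l _ => ?_
  split_ifs <;> simp_all

lemma partialSum_single_sub (a : Fin n) (u : Fin n → ℤ) (p : ℕ) :
    partialSum (fun k => (if k = a then 1 else 0) - u k) p =
      (if (a : ℕ) < p then 1 else 0) - partialSum u p := by
  unfold partialSum
  have : (if (a : ℕ) < p then (1 : ℤ) else 0) =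
      ∑ k : Fin n, if k = a then (if (k : ℕ) < p then 1 else 0) else 0 := by simp
  rw [this, ← Finset.sum_sub_distrib]
  refine Finset.sum_congr rfl fun k _ => ?_
  split_ifs <;> simp_all

lemma IsMatching.partialSum_nonneg (h : IsMatching ι) (a : Fin n) (p : ℕ) :
    0 ≤ partialSum (ι a) p := by
  refine Finset.sum_nonneg fun k _ => ?_
  have := h.nonneg a k
  split_ifs <;> omega

lemma IsMatching.partialSum_le_one (h : IsMatching ι) (a : Fin n) (p : ℕ) :
    partialSum (ι a) p ≤ 1 := by
  refine le_trans (Finset.sum_le_sum fun k _ => ?_) (h.row a)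
  have := h.nonneg a k
  split_ifs <;> omega

lemma IsMatching.partialSum_eq_zero (h : IsMatching ι) (a : Fin n) (p : ℕ) :
    partialSum (ι a) p = 0 ↔ ∀ k : Fin n, (k : ℕ) < p → ι a k = 0 := by
  unfold partialSum
  rw [Finset.sum_eq_zero_iff_of_nonneg]
  · simp
  · intro k _
    have := h.nonneg a k
    split_ifs <;> omega

lemma IsMatching.eq_of_ne_zero (h : IsMatching ι) {k l l' : Fin n} (h1 : ι k l ≠ 0)
    (h2 : ι k l' ≠ 0) : l = l' := by
  by_contra hne
  have h3 : ∑ x ∈ {l, l'}, ι k x ≤ ∑ x, ι k x :=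
    Finset.sum_le_sum_of_subset_of_nonneg (Finset.subset_univ _) fun i _ _ => h.nonneg k i
  rw [Finset.sum_pair hne] at h3
  have := h.row k
  have := h.nonneg k l
  have := h.nonneg k l'
  omega

lemma IsMatching.le_one (h : IsMatching ι) (k l : Fin n) : ι k l ≤ 1 :=
  (Finset.single_le_sum (fun i _ => h.nonneg k i) (Finset.mem_univ l)).trans (h.row k)

/-- The difference of the two sums is the sum over the block of rows below `p` and columns from `b`
to `q - 1`, where all entries are nonnegative and the one at `(a, b)` is at least one. -/
lemma cornerSum_add_one_le {d : Fin n → Fin n → ℤ} {a b : Fin n} {p q : ℕ} (ha : (a : ℕ) < p)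
    (hb : (b : ℕ) < q) (hd : ∀ k l : Fin n, (k : ℕ) < p → b ≤ l → (l : ℕ) < q → 0 ≤ d k l)
    (hab : 1 ≤ d a b) : cornerSum d p b + 1 ≤ cornerSum d p q := by
  have key : cornerSum d p q - cornerSum d p b =
      ∑ x : Fin n × Fin n, if (x.1 : ℕ) < p ∧ b ≤ x.2 ∧ (x.2 : ℕ) < q then d x.1 x.2 else 0 := by
    unfold cornerSum
    rw [Fintype.sum_prod_type]
    simp only [← Finset.sum_sub_distrib]
    refine Finset.sum_congr rfl fun k _ => Finset.sum_congr rfl fun l _ => ?_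
    simp only [Fin.le_def]
    split_ifs <;> omega
  have h2 := Finset.single_le_sum (f := fun x : Fin n × Fin n =>
    if (x.1 : ℕ) < p ∧ b ≤ x.2 ∧ (x.2 : ℕ) < q then d x.1 x.2 else 0) (s := Finset.univ)
    (fun x _ => by
      split_ifs with h
      · exact hd _ _ h.1 h.2.1 h.2.2
      · exact le_rfl) (Finset.mem_univ (a, b))
  simp only [ha, hb, le_refl, and_self, if_true] at h2
  omega

/-- The matching obtained by making `a` and `c` partners, as well as their former partners. -/
def swapMatching (ι : Fin n → Fin n → ℤ) (a c k l : Fin n) : ℤ :=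
  ι k l + ((if k = a then 1 else 0) - ι c k) * ((if l = c then 1 else 0) - ι a l) +
    ((if k = c then 1 else 0) - ι a k) * ((if l = a then 1 else 0) - ι c l)

lemma cornerSum_swapMatching (ι : Fin n → Fin n → ℤ) (a c : Fin n) (p q : ℕ) :
    cornerSum (swapMatching ι a c) p q = cornerSum ι p q +
      ((if (a : ℕ) < p then 1 else 0) - partialSum (ι c) p) *
        ((if (c : ℕ) < q then 1 else 0) - partialSum (ι a) q) +
      ((if (c : ℕ) < p then 1 else 0) - partialSum (ι a) p) *
        ((if (a : ℕ) < q then 1 else 0) - partialSum (ι c) q) := by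
  unfold swapMatching
  rw [cornerSum_add, cornerSum_add, cornerSum_mul, cornerSum_mul]
  simp only [partialSum_single_sub]

/-- A matching below a perfect matching `z` for the order given by corner sums is strictly below
some swap of it, which is still below `z`. -/
lemma exists_swapMatching_le {z : Equiv.Perm (Fin n)} (hz : Function.Involutive z)
    (hfpf : ∀ i, z i ≠ i) (hι : IsMatching ι)
    (hle : ∀ p q, cornerSum ι p q ≤ cornerSum (permInd z) p q) (hne : ι ≠ permInd z) :
    ∃ a c : Fin n, a < c ∧ (∀ l ≤ c, ι a l = 0) ∧ (∀ l ≤ a, ι c l = 0) ∧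
      (∀ p q, cornerSum ι p q ≤ cornerSum (swapMatching ι a c) p q) ∧
      (∀ p q, cornerSum (swapMatching ι a c) p q ≤ cornerSum (permInd z) p q) ∧
      cornerSum ι (a + 1) (c + 1) < cornerSum (swapMatching ι a c) (a + 1) (c + 1) := by
  have hzm := permInd_isMatching hz hfpf
  have hex : (Finset.univ.filter fun k => ι k (z k) = 0).Nonempty := by
    by_contra hcon
    rw [Finset.not_nonempty_iff_eq_empty, Finset.filter_eq_empty_iff] at hcon
    refine hne (funext fun k => funext fun l => ?_)
    have hk := hcon (Finset.mem_univ k)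
    unfold permInd
    split_ifs with h
    · subst h
      have := hι.nonneg k (z k)
      have := hι.le_one k (z k)
      omega
    · by_contra h2
      exact h (hι.eq_of_ne_zero hk h2)
  -- `a` is the first index whose partner under `z` is not its partner under `ι`; the rows before it
  -- agree.
  obtain ⟨a, ha, hmin⟩ := Finset.exists_min_image _ id hex
  simp only [Finset.mem_filter, Finset.mem_univ, true_and, id] at ha hmin
  have hlow : ∀ k < a, ∀ l, ι k l = permInd z k l := by
    intro k hk l
    have hk0 : ι k (z k) ≠ 0 := fun h => (hmin k h).not_gt hk
    unfold permInd
    split_ifs with h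
    · subst h
      have := hι.nonneg k (z k)
      have := hι.le_one k (z k)
      omega
    · by_contra h2
      exact h (hι.eq_of_ne_zero hk0 h2)
  obtain ⟨b, hb⟩ : ∃ b, b = z a := ⟨_, rfl⟩
  have hzab : permInd z a b = 1 := by simp [permInd, hb]
  rw [← hb] at ha
  have hab : a < b := by
    by_contra h
    have h1 : b < a := lt_of_le_of_ne (not_lt.1 h) (by rw [hb]; exact hfpf a)
    have := hlow b h1 a
    rw [hι.symm, ha, hzm.symm, hzab] at this
    omega
  -- Compare corners at `(a + 1, b)`: the earlier rows agree, and row `a` of `z` has its only `1` in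
  -- column `b`, just outside.
  have hrow : ∀ l ≤ b, ι a l = 0 := by
    have h1 := hle (a + 1) b
    rw [cornerSum_succ, cornerSum_permInd_succ, ← hb, if_neg (lt_irrefl _)] at h1
    have h2 : cornerSum ι a b = cornerSum (permInd z) a b := by
      unfold cornerSum
      refine Finset.sum_congr rfl fun k _ => Finset.sum_congr rfl fun l _ => ?_
      split_ifs with h
      · exact hlow k h.1 l
      · rfl
    have h3 : partialSum (ι a) b = 0 :=
      le_antisymm (by unfold partialSum; omega) (hι.partialSum_nonneg a b)
    rw [hι.partialSum_eq_zero] at h3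
    intro l hl
    rcases hl.lt_or_eq with hl | rfl
    · exact h3 l hl
    · exact ha
  -- Candidates for the new partner of `a`: points from `b` on, before the partner of `a` (if any),
  -- whose own partner (if any) comes after `a`. Among these `c` is taken with the smallest partner;
  -- if none is matched, `c = b` will do.
  obtain ⟨C, hC⟩ : ∃ C : Set (Fin n),
    C = {c | b ≤ c ∧ (∀ l ≤ c, ι a l = 0) ∧ ∀ k ≤ a, ι c k = 0} := ⟨_, rfl⟩
  have hbC : b ∈ C := by
    rw [hC]
    refine ⟨le_rfl, hrow, fun k hk => ?_⟩
    rw [hι.symm]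
    rcases hk.lt_or_eq with hk | rfl
    · rw [hlow k hk, permInd, if_neg]
      rw [hb]
      exact fun h => hk.ne (z.injective h)
    · exact ha
  obtain ⟨c, hcC, hcmin⟩ : ∃ c ∈ C, ∀ c' ∈ C, ∀ j', ι c' j' ≠ 0 → ∃ j ≤ j', ι c j ≠ 0 := by
    by_cases h : ∃ j', ∃ c' ∈ C, ι c' j' ≠ 0
    · classical
      obtain ⟨j, hj, hjmin⟩ := Finset.exists_min_image
        (Finset.univ.filter fun j' => ∃ c' ∈ C, ι c' j' ≠ 0) id
        (by obtain ⟨j', hj'⟩ := h; exact ⟨j', by simpa using hj'⟩)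
      simp only [Finset.mem_filter, Finset.mem_univ, true_and, id] at hj hjmin
      obtain ⟨c, hc, hcj⟩ := hj
      exact ⟨c, hc, fun c' hc' j' hj' => ⟨j, hjmin j' ⟨c', hc', hj'⟩, hcj⟩⟩
    · exact ⟨b, hbC, fun c' hc' j' hj' => absurd ⟨j', c', hc', hj'⟩ h⟩
  have hcC' := hcC
  rw [hC] at hcC'
  obtain ⟨hbc, hac, hca⟩ := hcC'
  -- the two factors of the change of corner sums
  have hf1 : ∀ p : ℕ, ((if (a : ℕ) < p then 1 else 0) - partialSum (ι c) p = 0 ∨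
      ((if (a : ℕ) < p then 1 else 0) - partialSum (ι c) p = 1 ∧ (a : ℕ) < p ∧
        partialSum (ι c) p = 0)) := by
    intro p
    have h1 := hι.partialSum_nonneg c p
    have h2 := hι.partialSum_le_one c p
    split_ifs with h
    · omega
    · have : partialSum (ι c) p = 0 :=
        (hι.partialSum_eq_zero c p).2 fun k hk => hca k (Fin.le_def.2 (by omega))
      omega
  have hf2 : ∀ p : ℕ, ((if (c : ℕ) < p then 1 else 0) - partialSum (ι a) p = 0 ∨
      ((if (c : ℕ) < p then 1 else 0) - partialSum (ι a) p = 1 ∧ (c : ℕ) < p ∧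
        partialSum (ι a) p = 0)) := by
    intro p
    have h1 := hι.partialSum_nonneg a p
    have h2 := hι.partialSum_le_one a p
    split_ifs with h
    · omega
    · have : partialSum (ι a) p = 0 :=
        (hι.partialSum_eq_zero a p).2 fun k hk => hac k (Fin.le_def.2 (by omega))
      omega
  obtain ⟨d, hd⟩ : ∃ d : Fin n → Fin n → ℤ, d = fun k l => permInd z k l - ι k l := ⟨_, rfl⟩
  have hdsymm : ∀ k l, d k l = d l k := fun k l => by
    simp only [hd, hzm.symm k l, hι.symm k l]
  have hdab : 1 ≤ d a b := by simp [hd, hzab, ha]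
  have hcsd : ∀ p q, cornerSum d p q = cornerSum (permInd z) p q - cornerSum ι p q := by
    intro p q; rw [hd, cornerSum_sub]
  have hd0 : ∀ p q, 0 ≤ cornerSum d p q := fun p q => by
    have := hle p q
    rw [hcsd]; omega
  -- A nonzero entry of `ι` in this block, in a row after `a`, would make its column a candidate
  -- with a smaller partner than that of `c`.
  have hdpos : ∀ p q : ℕ, partialSum (ι c) p = 0 → partialSum (ι a) q = 0 →
      ∀ k l : Fin n, (k : ℕ) < p → b ≤ l → (l : ℕ) < q → 0 ≤ d k l := by
    intro p q hp hq k l hk hbl hl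
    rw [hι.partialSum_eq_zero] at hp hq
    rw [hd]
    have hz0 := permInd_nonneg z k l
    rcases lt_or_ge k a with hka | hka
    · simp [hlow k hka l]
    · have : ι k l = 0 := by
        rcases hka.eq_or_lt with rfl | hka
        · exact hq l hl
        · by_contra hkl
          have hlk : ι l k ≠ 0 := by rwa [hι.symm]
          have hlC : l ∈ C := by
            rw [hC]
            refine ⟨hbl, fun l' hl' => hq l' (by rw [Fin.le_def] at hl'; omega), fun k' hk' => ?_⟩
            by_contra h
            exact (hk'.trans_lt hka).ne (hι.eq_of_ne_zero h hlk)
          obtain ⟨j, hjk, hj⟩ := hcmin l hlC k hlk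
          exact hj (hp j (by rw [Fin.le_def] at hjk; omega))
      simp only [this]
      omega
  have hbc' : (b : ℕ) ≤ c := hbc
  have hab' : (a : ℕ) < b := hab
  have hone : ∀ p q : ℕ, (a : ℕ) < p → partialSum (ι c) p = 0 → (c : ℕ) < q →
      partialSum (ι a) q = 0 → cornerSum d p b + 1 ≤ cornerSum d p q := by
    intro p q h1 h2 h3 h4
    exact cornerSum_add_one_le h1 (by omega) (hdpos p q h2 h4) hdab
  refine ⟨a, c, hab.trans_le hbc, hac, hca, ?_, ?_, ?_⟩
  · intro p q
    rw [cornerSum_swapMatching]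
    rcases hf1 p with h1 | ⟨h1, -⟩ <;> rcases hf2 q with h2 | ⟨h2, -⟩ <;>
      rcases hf1 q with h3 | ⟨h3, -⟩ <;> rcases hf2 p with h4 | ⟨h4, -⟩ <;>
      rw [h1, h2, h3, h4] <;> omega
  · intro p q
    have h0 := hd0 p q
    have hs1 : partialSum (ι c) p = 0 → partialSum (ι a) q = 0 → (a : ℕ) < p → (c : ℕ) < q →
        1 ≤ cornerSum d p q := by
      intro h1 h2 h3 h4
      have := hone p q h3 h1 h4 h2
      have := hd0 p b
      omega
    have hs2 : partialSum (ι a) p = 0 → partialSum (ι c) q = 0 → (c : ℕ) < p → (a : ℕ) < q →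
        1 ≤ cornerSum d p q := by
      intro h1 h2 h3 h4
      rw [cornerSum_symm hdsymm]
      have := hone q p h4 h2 h3 h1
      have := hd0 q b
      omega
    -- Here both products in the swap formula equal one, so a gap of two is needed. The entry `d a
    -- b` is gained once going from column `b` to `q`, and, by symmetry, once more going from row
    -- `b` to `p`.
    have hs3 : partialSum (ι a) p = 0 → partialSum (ι c) q = 0 → partialSum (ι c) p = 0 →
        partialSum (ι a) q = 0 → (c : ℕ) < p → (c : ℕ) < q → 2 ≤ cornerSum d p q := by
      intro h1 h2 h3 h4 h5 h6
      have e1 := hone p q (by omega) h3 h6 h4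
      have e2 : cornerSum d b b + 1 ≤ cornerSum d b p :=
        cornerSum_add_one_le hab' (by omega)
          (fun k l hk hl hlp => hdpos p p h3 h1 k l (by omega) hl hlp) hdab
      rw [cornerSum_symm hdsymm b p] at e2
      have := hd0 b b
      omega
    rw [hcsd] at h0 hs1 hs2 hs3
    rw [cornerSum_swapMatching]
    rcases hf1 p with h1 | ⟨h1, g1, k1⟩ <;> rcases hf2 q with h2 | ⟨h2, g2, k2⟩ <;>
      rcases hf1 q with h3 | ⟨h3, g3, k3⟩ <;> rcases hf2 p with h4 | ⟨h4, g4, k4⟩ <;>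
      rw [h1, h2, h3, h4] <;> omega
  · rw [cornerSum_swapMatching]
    have e1 : partialSum (ι c) (a + 1) = 0 :=
      (hι.partialSum_eq_zero _ _).2 fun k hk => hca k (Fin.le_def.2 (by omega))
    have e2 : partialSum (ι a) (c + 1) = 0 :=
      (hι.partialSum_eq_zero _ _).2 fun k hk => hac k (Fin.le_def.2 (by omega))
    have e3 : ¬ ((c : ℕ) < a + 1) := by omega
    have e4 : partialSum (ι a) (a + 1) = 0 :=
      (hι.partialSum_eq_zero _ _).2 fun k hk => hac k (Fin.le_def.2 (by omega))
    rw [e1, e2, e4, if_neg e3]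
    simp

end swap

/-! ## Corner ranks of matrices -/

section cornerRk

open Matrix

/-- The rank of the submatrix of the rows `k < p` and columns `l < q`. -/
def cornerRk {n : ℕ} (A : Matrix (Fin n) (Fin n) ℂ) (p q : ℕ) : ℕ :=
  (A.submatrix (Subtype.val : {k : Fin n // (k : ℕ) < p} → Fin n)
    (Subtype.val : {l : Fin n // (l : ℕ) < q} → Fin n)).rank

/-- Lower unitriangular matrices. -/
structure IsUnitLower {n : ℕ} (g : Matrix (Fin n) (Fin n) ℂ) : Prop where
  eq_zero : ∀ i j, i < j → g i j = 0
  diag : ∀ i, g i i = 1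

/-- Skew-symmetric matrices with at most one nonzero entry in each row. -/
structure IsMono {n : ℕ} (M : Matrix (Fin n) (Fin n) ℂ) : Prop where
  skew : ∀ i j, M i j = -M j i
  row : ∀ i j l, M i j ≠ 0 → M i l ≠ 0 → j = l

/-- The indicator of the nonzero entries. -/
def supp {n : ℕ} (M : Matrix (Fin n) (Fin n) ℂ) (k l : Fin n) : ℤ :=
  open Classical in if M k l ≠ 0 then 1 else 0

variable {n : ℕ}

lemma isUnitLower_one : IsUnitLower (1 : Matrix (Fin n) (Fin n) ℂ) :=
  ⟨fun _ _ h => Matrix.one_apply_ne h.ne, fun _ => Matrix.one_apply_eq _⟩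

lemma IsUnitLower.mul {g h : Matrix (Fin n) (Fin n) ℂ} (hg : IsUnitLower g)
    (hh : IsUnitLower h) : IsUnitLower (g * h) where
  eq_zero i j hij := by
    rw [Matrix.mul_apply]
    refine Finset.sum_eq_zero fun k _ => ?_
    rcases lt_or_ge i k with h1 | h1
    · rw [hg.eq_zero i k h1, zero_mul]
    · rw [hh.eq_zero k j (h1.trans_lt hij), mul_zero]
  diag i := by
    rw [Matrix.mul_apply, Finset.sum_eq_single i]
    · rw [hg.diag, hh.diag, one_mul]
    · intro k _ hk
      rcases lt_or_gt_of_ne hk with h1 | h1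
      · rw [hh.eq_zero k i h1, mul_zero]
      · rw [hg.eq_zero i k h1, zero_mul]
    · simp

lemma IsUnitLower.det_submatrix {g : Matrix (Fin n) (Fin n) ℂ} (hg : IsUnitLower g) (p : ℕ) :
    (g.submatrix (Subtype.val : {k : Fin n // (k : ℕ) < p} → Fin n) Subtype.val).det = 1 := by
  rw [Matrix.det_of_isLowerTriangular]
  · simp [hg.diag]
  · intro i j hij
    exact hg.eq_zero _ _ hij

lemma IsUnitLower.det {g : Matrix (Fin n) (Fin n) ℂ} (hg : IsUnitLower g) : g.det = 1 := by
  rw [Matrix.det_of_isLowerTriangular]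
  · simp [hg.diag]
  · intro i j hij
    exact hg.eq_zero _ _ hij

lemma IsUnitLower.sum_mul {g : Matrix (Fin n) (Fin n) ℂ} (hg : IsUnitLower g) {p : ℕ} {k : Fin n}
    (hk : (k : ℕ) < p) (f : Fin n → ℂ) :
    ∑ x, g k x * f x = ∑ x : {x : Fin n // (x : ℕ) < p}, g k x * f x := by
  rw [← Finset.sum_subtype (Finset.univ.filter fun x : Fin n => (x : ℕ) < p) (by simp)
    (fun x => g k x * f x), Finset.sum_filter]
  refine Finset.sum_congr rfl fun x _ => ?_
  split_ifs with h
  · rfl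
  · rw [hg.eq_zero k x (Fin.lt_def.2 (by omega)), zero_mul]

/-- By triangularity the corner of `g * A * gᵀ` is the corner of `A` multiplied on both sides by
square corners of `g` and `gᵀ`, which have determinant one. -/
lemma IsUnitLower.cornerRk_conj {g : Matrix (Fin n) (Fin n) ℂ} (hg : IsUnitLower g)
    (A : Matrix (Fin n) (Fin n) ℂ) (p q : ℕ) : cornerRk (g * A * gᵀ) p q = cornerRk A p q := by
  unfold cornerRk
  have : (g * A * gᵀ).submatrix (Subtype.val : {k : Fin n // (k : ℕ) < p} → Fin n)
      (Subtype.val : {l : Fin n // (l : ℕ) < q} → Fin n) =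
      g.submatrix (Subtype.val : {k : Fin n // (k : ℕ) < p} → Fin n)
          (Subtype.val : {k : Fin n // (k : ℕ) < p} → Fin n) *
        (A.submatrix (Subtype.val : {k : Fin n // (k : ℕ) < p} → Fin n)
          (Subtype.val : {k : Fin n // (k : ℕ) < q} → Fin n) *
        (g.submatrix (Subtype.val : {k : Fin n // (k : ℕ) < q} → Fin n)
          (Subtype.val : {k : Fin n // (k : ℕ) < q} → Fin n))ᵀ) := by
    ext ⟨k, hk⟩ ⟨l, hl⟩
    rw [Matrix.mul_assoc]
    simp only [Matrix.submatrix_apply, Matrix.mul_apply, Matrix.transpose_apply]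
    rw [hg.sum_mul hk]
    refine Finset.sum_congr rfl fun x _ => ?_
    congr 1
    simp only [mul_comm (A _ _)]
    rw [hg.sum_mul hl]
  rw [this, Matrix.rank_mul_eq_right_of_isUnit_det _ _ (by rw [hg.det_submatrix]; exact isUnit_one),
    Matrix.rank_mul_eq_left_of_isUnit_det _ _
      (by rw [Matrix.det_transpose, hg.det_submatrix]; exact isUnit_one)]

/-- The nonzero rows have disjoint supports, so they form a basis of the row space. -/
lemma rank_eq_card_of_unique {m m' : Type*} [Fintype m] [Fintype m']
    (M : Matrix m m' ℂ)
    (hcol : ∀ i k j, M i j ≠ 0 → M k j ≠ 0 → i = k) :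
    M.rank = Nat.card {i // ∃ j, M i j ≠ 0} := by
  classical
  have hli : LinearIndependent ℂ (fun i : {i // ∃ j, M i j ≠ 0} => M i) := by
    rw [Fintype.linearIndependent_iff]
    rintro c hc ⟨i, j, hij⟩
    have h1 := congrFun hc j
    simp only [Finset.sum_apply, Pi.smul_apply, smul_eq_mul, Pi.zero_apply] at h1
    rw [Finset.sum_eq_single ⟨i, j, hij⟩] at h1
    · exact (mul_eq_zero.1 h1).resolve_right hij
    · rintro ⟨k, hk⟩ _ hne
      have : M k j = 0 := by
        by_contra h
        exact hne (Subtype.ext (hcol k i j h hij))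
      simp [this]
    · simp
  rw [Matrix.rank_eq_finrank_span_row, Nat.card_eq_fintype_card, ← finrank_span_eq_card hli]
  have : Submodule.span ℂ (Set.range M.row) =
      Submodule.span ℂ (Set.range fun i : {i // ∃ j, M i j ≠ 0} => M i) := by
    apply le_antisymm
    · rw [Submodule.span_le]
      rintro _ ⟨i, rfl⟩
      by_cases h : ∃ j, M i j ≠ 0
      · exact Submodule.subset_span ⟨⟨i, h⟩, rfl⟩
      · push Not at h
        have : M.row i = 0 := funext h
        rw [this]
        exact Submodule.zero_mem _
    · apply Submodule.span_mono
      rintro _ ⟨i, rfl⟩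
      exact ⟨i, rfl⟩
  rw [this]

lemma cornerRk_of_unique (M : Matrix (Fin n) (Fin n) ℂ)
    (hrow : ∀ i j l, M i j ≠ 0 → M i l ≠ 0 → j = l)
    (hcol : ∀ i k j, M i j ≠ 0 → M k j ≠ 0 → i = k) (p q : ℕ) :
    (cornerRk M p q : ℤ) = cornerSum (supp M) p q := by
  classical
  unfold cornerRk
  rw [rank_eq_card_of_unique]
  · have : ∀ k : Fin n, (∑ l : Fin n, if (k : ℕ) < p ∧ (l : ℕ) < q then supp M k l else 0) =
        if (∃ _ : (k : ℕ) < p, ∃ l : {l : Fin n // (l : ℕ) < q}, M k l ≠ 0) then 1 else 0 := by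
      intro k
      split_ifs with h
      · obtain ⟨h1, ⟨l, h2⟩, h3⟩ := h
        rw [Finset.sum_eq_single l]
        · simp [h1, h2, supp, h3]
        · intro l' _ hl'
          have : M k l' = 0 := by
            by_contra h4
            exact hl' (hrow k _ _ h4 h3)
          simp [supp, this]
        · simp
      · refine Finset.sum_eq_zero fun l _ => ?_
        split_ifs with h2
        · have : M k l = 0 := by
            by_contra h4
            exact h ⟨h2.1, ⟨l, h2.2⟩, h4⟩
          simp [supp, this]
        · rfl
    unfold cornerSum
    rw [Finset.sum_congr rfl fun k _ => this k, Finset.sum_boole, ← Fintype.card_subtype,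
      ← Nat.card_eq_fintype_card]
    congr 1
    refine Nat.card_congr ⟨fun x => ⟨x.1.1, x.1.2, x.2⟩, fun x => ⟨⟨x.1, x.2.choose⟩, ?_⟩,
      fun x => rfl, fun x => rfl⟩
    obtain ⟨h, h'⟩ := x.2
    exact h'
  · intro i k j h1 h2
    exact Subtype.ext (hcol _ _ _ h1 h2)

lemma IsMono.col {M : Matrix (Fin n) (Fin n) ℂ} (hM : IsMono M) (i k j : Fin n) (h1 : M i j ≠ 0)
    (h2 : M k j ≠ 0) : i = k := by
  rw [hM.skew, neg_ne_zero] at h1 h2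
  exact hM.row j i k h1 h2

lemma IsMono.cornerRk_eq {M : Matrix (Fin n) (Fin n) ℂ} (hM : IsMono M) (p q : ℕ) :
    (cornerRk M p q : ℤ) = cornerSum (supp M) p q :=
  cornerRk_of_unique M hM.row hM.col p q

lemma IsMono.isMatching {M : Matrix (Fin n) (Fin n) ℂ} (hM : IsMono M) : IsMatching (supp M) where
  nonneg k l := by unfold supp; split_ifs <;> simp
  symm k l := by unfold supp; rw [hM.skew k l]; simp
  diag k := by
    have : M k k = 0 := CharZero.eq_neg_self_iff.1 (hM.skew k k)
    simp [supp, this]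
  row k := by
    classical
    by_cases h : ∃ j, M k j ≠ 0
    · obtain ⟨j, hj⟩ := h
      rw [Finset.sum_eq_single j]
      · unfold supp; simp [hj]
      · intro l _ hl
        have : M k l = 0 := by
          by_contra h4
          exact hl (hM.row k _ _ h4 hj)
        simp [supp, this]
      · simp
    · push Not at h
      simp [supp, h]

/-- Schur elimination of a pivot in position `(a, c)`. -/
lemma exists_pivot {A : Matrix (Fin n) (Fin n) ℂ} (hA : ∀ i j, A i j = -A j i) {a c : Fin n}
    (hac : a ≠ c) (ht : A a c ≠ 0) (ha : ∀ l < c, A a l = 0) (hc : ∀ l < a, A c l = 0) :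
    ∃ g : Matrix (Fin n) (Fin n) ℂ, IsUnitLower g ∧ ∀ k l, (g * A * gᵀ) k l =
      if k = a then (if l = c then A a c else 0)
      else if k = c then (if l = a then -A a c else 0)
      else if l = a ∨ l = c then 0
      else A k l + (A k a * A c l - A k c * A a l) / A a c := by
  -- Row `k` receives `α k` times row `a` and `β k` times row `c`, with coefficients chosen to clear
  -- columns `c` and `a`. The vanishing of `A c l` for `l < a` and of `A a l` for `l < c` is what
  -- makes `g` lower triangular.
  obtain ⟨α, hα⟩ : ∃ α : Fin n → ℂ, α = fun k => if k = a ∨ k = c then 0 else A c k / A a c :=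
    ⟨_, rfl⟩
  obtain ⟨β, hβ⟩ : ∃ β : Fin n → ℂ, β = fun k => if k = a ∨ k = c then 0 else -A a k / A a c :=
    ⟨_, rfl⟩
  obtain ⟨g, hg⟩ : ∃ g : Matrix (Fin n) (Fin n) ℂ, g = 1 + Matrix.vecMulVec α (Pi.single a 1) +
    Matrix.vecMulVec β (Pi.single c 1) := ⟨_, rfl⟩
  have hgk : ∀ k x, g k x = (if k = x then 1 else 0) + α k * (if x = a then 1 else 0) +
      β k * (if x = c then 1 else 0) := by
    intro k x
    simp [hg, Matrix.vecMulVec_apply, Matrix.one_apply, Pi.single_apply]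
  have hsum : ∀ k (f : Fin n → ℂ), ∑ x, g k x * f x = f k + α k * f a + β k * f c := by
    intro k f
    simp [hgk, add_mul, Finset.sum_add_distrib]
  have haa : A a a = 0 := CharZero.eq_neg_self_iff.1 (hA a a)
  have hcc : A c c = 0 := CharZero.eq_neg_self_iff.1 (hA c c)
  have hca : A c a = -A a c := hA c a
  refine ⟨g, ⟨?_, ?_⟩, ?_⟩
  · intro i j hij
    rw [hgk, if_neg hij.ne]
    have h1 : α i * (if j = a then 1 else 0) = 0 := by
      split_ifs with h
      · subst h; simp [hα, hc i hij]
      · simp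
    have h2 : β i * (if j = c then 1 else 0) = 0 := by
      split_ifs with h
      · subst h; simp [hβ, ha i hij]
      · simp
    rw [h1, h2]; simp
  · intro i
    rw [hgk]
    have h1 : α i * (if i = a then 1 else 0) = 0 := by
      split_ifs with h <;> simp [hα, h]
    have h2 : β i * (if i = c then 1 else 0) = 0 := by
      split_ifs with h <;> simp [hβ, h]
    rw [h1, h2]; simp
  · intro k l
    have hexp : (g * A * gᵀ) k l = (A k l + α k * A a l + β k * A c l) +
        α l * (A k a + α k * A a a + β k * A c a) + β l * (A k c + α k * A a c + β k * A c c) := by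
      rw [Matrix.mul_apply]
      simp only [Matrix.transpose_apply, mul_comm _ (g l _)]
      rw [hsum]
      simp only [Matrix.mul_apply, hsum]
    rw [hexp, haa, hcc, hca]
    have hka : A k a = -A a k := hA k a
    have hkc : A k c = -A c k := hA k c
    have hαa : α a = 0 := by simp [hα]
    have hαc : α c = 0 := by simp [hα]
    have hβa : β a = 0 := by simp [hβ]
    have hβc : β c = 0 := by simp [hβ]
    by_cases h1 : k = a
    · subst h1
      rw [if_pos rfl, hαa, hβa, haa]
      by_cases h2 : l = c
      · subst h2; simp [hαc, hβc]
      · rw [if_neg h2]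
        by_cases h3 : l = k
        · subst h3; simp [haa, hβa]
        · simp only [hβ, h3, h2, or_self, if_false]
          field_simp
          ring
    · rw [if_neg h1]
      by_cases h2 : k = c
      · subst h2
        rw [if_pos rfl, hαc, hβc, hcc, hca]
        by_cases h3 : l = a
        · subst h3; simp [hαa, hβa, hca]
        · rw [if_neg h3]
          by_cases h4 : l = k
          · subst h4; simp [hcc, hαc]
          · simp only [hα, h3, h4, or_self, if_false]
            field_simp
            ring
      · rw [if_neg h2]
        have hαk : α k = A c k / A a c := by simp [hα, h1, h2]
        have hβk : β k = -A a k / A a c := by simp [hβ, h1, h2]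
        by_cases h3 : l = a
        · subst h3
          rw [if_pos (Or.inl rfl), hαa, hβa, haa, hca, hβk, hka]
          field_simp
          ring
        · by_cases h4 : l = c
          · subst h4
            rw [if_pos (Or.inr rfl), hαc, hβc, hcc, hαk, hkc]
            field_simp
            ring
          · rw [if_neg (by simp [h3, h4])]
            have hαl : α l = A c l / A a c := by simp [hα, h3, h4]
            have hβl : β l = -A a l / A a c := by simp [hβ, h3, h4]
            rw [hαk, hβk, hαl, hβl, hka, hkc]
            field_simp
            ring

lemma skew_conj {A : Matrix (Fin n) (Fin n) ℂ} (hA : ∀ i j, A i j = -A j i)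
    (g : Matrix (Fin n) (Fin n) ℂ) : ∀ i j, (g * A * gᵀ) i j = -(g * A * gᵀ) j i := by
  have h : Aᵀ = -A := by
    ext i j; exact hA j i
  have h2 : (g * A * gᵀ)ᵀ = -(g * A * gᵀ) := by
    rw [Matrix.transpose_mul, Matrix.transpose_mul, Matrix.transpose_transpose, h]
    simp [Matrix.mul_assoc]
  intro i j
  exact congrFun (congrFun h2 j) i

/-- Every skew-symmetric matrix is congruent to a monomial one, by a lower unitriangular matrix. -/
lemma exists_isMono {A : Matrix (Fin n) (Fin n) ℂ} (hA : ∀ i j, A i j = -A j i) :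
    ∃ g : Matrix (Fin n) (Fin n) ℂ, IsUnitLower g ∧ IsMono (g * A * gᵀ) := by
  -- Induct on the number of finished rows: a nonzero entry in a finished row must be alone in its
  -- row, and its mirror image alone in the partner's row.
  suffices H : ∀ m ≤ n, ∃ g : Matrix (Fin n) (Fin n) ℂ, IsUnitLower g ∧ ∀ i : Fin n, (i : ℕ) < m → ∀ j,
      (g * A * gᵀ) i j ≠ 0 → (∀ l, (g * A * gᵀ) i l ≠ 0 → l = j) ∧
        ∀ l, (g * A * gᵀ) j l ≠ 0 → l = i by
    obtain ⟨g, hg, h⟩ := H n le_rfl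
    exact ⟨g, hg, skew_conj hA g, fun i j l h1 h2 => ((h i i.2 j h1).1 l h2).symm⟩
  intro m
  induction m with
  | zero => exact fun _ => ⟨1, isUnitLower_one, fun i hi => absurd hi (Nat.not_lt_zero _)⟩
  | succ m ih =>
    intro hm
    obtain ⟨g, hg, hgm⟩ := ih (by omega)
    obtain ⟨M, hM⟩ : ∃ M, M = g * A * gᵀ := ⟨_, rfl⟩
    have hMs : ∀ i j, M i j = -M j i := hM ▸ skew_conj hA g
    have hMsn : ∀ i j, M i j ≠ 0 → M j i ≠ 0 := fun i j h => by rwa [hMs, neg_ne_zero] at h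
    rw [← hM] at hgm
    obtain ⟨k, hk⟩ : ∃ k : Fin n, (k : ℕ) = m := ⟨⟨m, by omega⟩, rfl⟩
    have hcases : ∀ i : Fin n, (i : ℕ) < m + 1 → (i : ℕ) < m ∨ i = k := by
      intro i hi
      rcases Nat.lt_succ_iff_lt_or_eq.1 hi with h | h
      · exact Or.inl h
      · exact Or.inr (Fin.ext (by omega))
    by_cases hzero : ∀ j, k ≤ j → M k j = 0
    · refine ⟨g, hg, ?_⟩
      rw [← hM]
      intro i hi j hij
      rcases hcases i hi with h | rfl
      · exact hgm i h j hij
      · have hj : (j : ℕ) < m := by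
          by_contra h
          exact hij (hzero j (Fin.le_def.2 (by omega)))
        exact (hgm j hj i (hMsn _ _ hij)).symm
    push Not at hzero
    by_cases hlow : ∃ j : Fin n, (j : ℕ) < m ∧ M k j ≠ 0
    · refine ⟨g, hg, ?_⟩
      rw [← hM]
      obtain ⟨j0, hj0, hkj0⟩ := hlow
      have h0 := (hgm j0 hj0 k (hMsn _ _ hkj0)).symm
      intro i hi j hij
      rcases hcases i hi with h | rfl
      · exact hgm i h j hij
      · obtain rfl := h0.1 j hij
        exact h0
    push Not at hlow
    have hne : (Finset.univ.filter fun j => M k j ≠ 0).Nonempty := by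
      obtain ⟨j, -, hj⟩ := hzero
      exact ⟨j, by simpa using hj⟩
    obtain ⟨c, hc, hcmin⟩ := Finset.exists_min_image _ id hne
    simp only [Finset.mem_filter, Finset.mem_univ, true_and, id] at hc hcmin
    have hkk : M k k = 0 := CharZero.eq_neg_self_iff.1 (hMs k k)
    have hkc : k ≠ c := by rintro rfl; exact hc hkk
    have hkc' : k < c := by
      refine lt_of_le_of_ne (Fin.le_def.2 ?_) hkc
      by_contra h
      exact hc (hlow c (by omega))
    have hcl : ∀ l : Fin n, (l : ℕ) < m → M c l = 0 := by
      intro l hl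
      by_contra h
      have := (hgm l hl c (hMsn _ _ h)).2 k (hMsn _ _ hc)
      subst this
      omega
    obtain ⟨h, hh, hform⟩ := exists_pivot hMs hkc hc
      (fun l hl => by by_contra h; exact (hcmin l h).not_gt hl)
      (fun l hl => hcl l (by rw [Fin.lt_def] at hl; omega))
    obtain ⟨N, hN⟩ : ∃ N, N = h * M * hᵀ := ⟨_, rfl⟩
    rw [← hN] at hform
    refine ⟨h * g, hh.mul hg, ?_⟩
    have hNe : h * g * A * (h * g)ᵀ = N := by
      rw [hN, hM, Matrix.transpose_mul]
      simp only [Matrix.mul_assoc]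
    rw [hNe]
    -- The elimination does not touch rows vanishing in both pivot columns. This protects the
    -- finished rows and their partners.
    have hNrow : ∀ i, i ≠ k → i ≠ c → M i k = 0 → M i c = 0 → ∀ l, N i l = M i l := by
      intro i h1 h2 h3 h4 l
      rw [hform, if_neg h1, if_neg h2]
      split_ifs with h5
      · rcases h5 with rfl | rfl
        · exact h3.symm
        · exact h4.symm
      · simp [h3, h4]
    have hNk : ∀ l, N k l ≠ 0 → l = c := by
      intro l hl
      by_contra h
      exact hl (by rw [hform, if_pos rfl, if_neg h])
    have hNc : ∀ l, N c l ≠ 0 → l = k := by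
      intro l hl
      by_contra h
      exact hl (by rw [hform, if_neg hkc.symm, if_pos rfl, if_neg h])
    intro i hi j hij
    rcases hcases i hi with him | rfl
    · have hik : i ≠ k := by rintro rfl; omega
      have hic : i ≠ c := by rintro rfl; rw [Fin.lt_def] at hkc'; omega
      have h1 : M i k = 0 := by rw [hMs, hlow i him, neg_zero]
      have h2 : M i c = 0 := by rw [hMs, hcl i him, neg_zero]
      have hNi := hNrow i hik hic h1 h2
      rw [hNi] at hij
      have hjk : j ≠ k := by rintro rfl; exact hij h1
      have hjc : j ≠ c := by rintro rfl; exact hij h2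
      obtain ⟨e1, e2⟩ := hgm i him j hij
      have h3 : M j k = 0 := by
        by_contra h; exact hik (e2 k h).symm
      have h4 : M j c = 0 := by
        by_contra h; exact hic (e2 c h).symm
      have hNj := hNrow j hjk hjc h3 h4
      refine ⟨fun l hl => e1 l (by rwa [hNi] at hl), fun l hl => e2 l (by rwa [hNj] at hl)⟩
    · obtain rfl := hNk j hij
      exact ⟨hNk, hNc⟩

end cornerRk

/-! ## Closures of rank loci -/

section closure

open Matrix Filter Topology

variable {n : ℕ}

/-- Skew-symmetric matrices whose corner ranks are those of `z`. -/
def rankLocus (z : Equiv.Perm (Fin n)) : Set (Matrix (Fin n) (Fin n) ℂ) :=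
  {A | (∀ i j, A i j = -A j i) ∧ ∀ p q, (cornerRk A p q : ℤ) = cornerSum (permInd z) p q}

/-- Conjugating back by `g` recovers `A`, so only `g`, and not its inverse `h`, has to be known to
be unitriangular. -/
lemma conj_mem_rankLocus {z : Equiv.Perm (Fin n)} {A g h : Matrix (Fin n) (Fin n) ℂ}
    (hg : IsUnitLower g) (hgh : g * h = 1) (hA : A ∈ rankLocus z) :
    h * A * hᵀ ∈ rankLocus z := by
  refine ⟨skew_conj hA.1 h, fun p q => ?_⟩
  rw [← hA.2, ← hg.cornerRk_conj (h * A * hᵀ)]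
  have : g * (h * A * hᵀ) * gᵀ = A := by
    have h1 : hᵀ * gᵀ = 1 := by rw [← Matrix.transpose_mul, hgh, Matrix.transpose_one]
    calc g * (h * A * hᵀ) * gᵀ = (g * h) * A * (hᵀ * gᵀ) := by simp only [Matrix.mul_assoc]
      _ = A := by rw [hgh, h1, Matrix.one_mul, Matrix.mul_one]
  rw [this]

lemma mem_closure_rankLocus_of_conj {z : Equiv.Perm (Fin n)} {A g : Matrix (Fin n) (Fin n) ℂ}
    (hg : IsUnitLower g) (h : g * A * gᵀ ∈ closure (rankLocus z)) :
    A ∈ closure (rankLocus z) := by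
  have hdet : IsUnit g.det := by rw [hg.det]; exact isUnit_one
  have h1 : g * g⁻¹ = 1 := Matrix.mul_nonsing_inv g hdet
  have h2 : g⁻¹ * g = 1 := Matrix.nonsing_inv_mul g hdet
  have hcont : Continuous fun X : Matrix (Fin n) (Fin n) ℂ => g⁻¹ * X * g⁻¹ᵀ := by fun_prop
  have := map_mem_closure hcont h (t := rankLocus z)
    (fun X hX => conj_mem_rankLocus hg h1 hX)
  have e : g⁻¹ * (g * A * gᵀ) * g⁻¹ᵀ = A := by
    have h3 : gᵀ * g⁻¹ᵀ = 1 := by rw [← Matrix.transpose_mul, h2, Matrix.transpose_one]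
    calc g⁻¹ * (g * A * gᵀ) * g⁻¹ᵀ = (g⁻¹ * g) * A * (gᵀ * g⁻¹ᵀ) := by
          simp only [Matrix.mul_assoc]
      _ = A := by rw [h2, h3, Matrix.one_mul, Matrix.mul_one]
  rwa [e] at this

/-- The matrix `t (e_a e_cᵀ - e_c e_aᵀ)`. -/
def skewUnit (a c : Fin n) (t : ℂ) : Matrix (Fin n) (Fin n) ℂ := fun k l =>
  if k = a ∧ l = c then t else if k = c ∧ l = a then -t else 0

/-- Adding a pivot to a monomial matrix swaps partners. -/
lemma IsMono.cornerRk_add_skewUnit {M : Matrix (Fin n) (Fin n) ℂ} (hM : IsMono M) {a c : Fin n}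
    (hac : a < c) (ha : ∀ l ≤ c, M a l = 0) (hc : ∀ l ≤ a, M c l = 0) {t : ℂ} (ht : t ≠ 0) :
    (∀ i j, (M + skewUnit a c t) i j = -(M + skewUnit a c t) j i) ∧
    ∀ p q, (cornerRk (M + skewUnit a c t) p q : ℤ) =
      cornerSum (swapMatching (supp M) a c) p q := by
  classical
  have hskew : ∀ i j, (M + skewUnit a c t) i j = -(M + skewUnit a c t) j i := by
    intro i j
    simp only [Matrix.add_apply, hM.skew i j, skewUnit]
    have := hac.ne
    grind
  refine ⟨hskew, fun p q => ?_⟩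
  obtain ⟨A, hA⟩ : ∃ A, A = M + skewUnit a c t := ⟨_, rfl⟩
  rw [← hA] at hskew ⊢
  have hAa : ∀ l, A a l = M a l + if l = c then t else 0 := by
    intro l; simp [hA, skewUnit, hac.ne]
  have hAc : ∀ l, A c l = M c l + if l = a then -t else 0 := by
    intro l; simp [hA, skewUnit, hac.ne']
  have hAo : ∀ k l, k ≠ a → k ≠ c → A k l = M k l := by
    intro k l h1 h2; simp [hA, skewUnit, h1, h2]
  have hAac : A a c = t := by rw [hAa, if_pos rfl, ha c le_rfl, zero_add]
  -- Eliminating with the new pivot `t` links the former partners of `a` and `c` through the Schur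
  -- complement term.
  obtain ⟨g, hg, hform⟩ := exists_pivot hskew hac.ne (by rwa [hAac])
    (fun l hl => by rw [hAa, if_neg hl.ne, ha l hl.le, add_zero])
    (fun l hl => by rw [hAc, if_neg hl.ne, hc l hl.le, add_zero])
  obtain ⟨N, hN⟩ : ∃ N, N = g * A * gᵀ := ⟨_, rfl⟩
  rw [← hN] at hform
  have hform' : ∀ k l, N k l =
      if k = a then (if l = c then t else 0)
      else if k = c then (if l = a then -t else 0)
      else if l = a ∨ l = c then 0
      else M k l + (M k a * M c l - M k c * M a l) / t := by
    intro k l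
    rw [hform, hAac]
    by_cases h1 : k = a
    · rw [if_pos h1, if_pos h1]
    by_cases h2 : k = c
    · rw [if_neg h1, if_neg h1, if_pos h2, if_pos h2]
    by_cases h3 : l = a ∨ l = c
    · simp only [h1, h2, h3, if_true, if_false]
    · simp only [h1, h2, h3, if_false]
      rw [not_or] at h3
      rw [hAo k l h1 h2, hAo k a h1 h2, hAo k c h1 h2, hAa, hAc, if_neg h3.1, if_neg h3.2,
        add_zero, add_zero]
  have haa : M a a = 0 := ha a hac.le
  have hcc : M c c = 0 := CharZero.eq_neg_self_iff.1 (hM.skew c c)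
  have hMac : M a c = 0 := ha c le_rfl
  have hMca : M c a = 0 := hc a le_rfl
  have hsymm : ∀ k l, M k l ≠ 0 ↔ M l k ≠ 0 := fun k l => by rw [hM.skew k l, neg_ne_zero]
  -- the nonzero entries away from the rows of the pivot
  have hcase : ∀ k l, k ≠ a → k ≠ c → l ≠ a → l ≠ c → (N k l ≠ 0 ↔
      M k l ≠ 0 ∨ (M k a ≠ 0 ∧ M c l ≠ 0) ∨ (M k c ≠ 0 ∧ M a l ≠ 0)) := by
    intro k l h1 h2 h3 h4
    -- At most one of `M k l`, `M k a`, `M k c` is nonzero, so the terms cannot cancel.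
    rw [hform', if_neg h1, if_neg h2, if_neg (by simp [h3, h4])]
    by_cases e1 : M k l = 0
    · by_cases e2 : M k a = 0
      · simp [e1, e2, ht]
      · have e3 : M k c = 0 := by
          by_contra h; exact hac.ne (hM.row k _ _ e2 h)
        simp [e1, e2, e3, ht]
    · have e2 : M k a = 0 := by
        by_contra h; exact h3 (hM.row k _ _ e1 h)
      have e3 : M k c = 0 := by
        by_contra h; exact h4 (hM.row k _ _ e1 h)
      simp [e1, e2, e3]
  have hNa : ∀ l, N a l ≠ 0 ↔ l = c := by
    intro l; rw [hform', if_pos rfl]; split_ifs with h <;> simp [h, ht]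
  have hNc : ∀ l, N c l ≠ 0 ↔ l = a := by
    intro l; rw [hform', if_neg hac.ne', if_pos rfl]; split_ifs with h <;> simp [h, ht]
  have hNo : ∀ k l, k ≠ a → k ≠ c → N k l ≠ 0 → l ≠ a ∧ l ≠ c := by
    intro k l h1 h2 h
    rw [hform', if_neg h1, if_neg h2] at h
    by_contra h3
    rw [if_pos (by tauto)] at h
    exact h rfl
  have hNmono : IsMono N := by
    refine ⟨hN ▸ skew_conj hskew g, fun i j l h1 h2 => ?_⟩
    by_cases hia : i = a
    · subst hia; rw [hNa] at h1 h2; rw [h1, h2]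
    by_cases hic : i = c
    · subst hic; rw [hNc] at h1 h2; rw [h1, h2]
    obtain ⟨e1, e2⟩ := hNo i j hia hic h1
    obtain ⟨e3, e4⟩ := hNo i l hia hic h2
    rw [hcase i j hia hic e1 e2] at h1
    rw [hcase i l hia hic e3 e4] at h2
    have r := hM.row
    rcases h1 with h1 | ⟨h1, h1'⟩ | ⟨h1, h1'⟩ <;> rcases h2 with h2 | ⟨h2, h2'⟩ | ⟨h2, h2'⟩
    · exact r i _ _ h1 h2
    · exact absurd (r i _ _ h1 h2) e1
    · exact absurd (r i _ _ h1 h2) e2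
    · exact absurd (r i _ _ h2 h1) e3
    · exact r c _ _ h1' h2'
    · exact absurd (r i _ _ h1 h2) hac.ne
    · exact absurd (r i _ _ h2 h1) e4
    · exact absurd (r i _ _ h2 h1) hac.ne
    · exact r a _ _ h1' h2'
  have hsupp : supp N = swapMatching (supp M) a c := by
    funext k l
    have hs := hM.isMatching.symm
    have s1 : supp M a a = 0 := by simp [supp, haa]
    have s2 : supp M c c = 0 := by simp [supp, hcc]
    have s3 : supp M a c = 0 := by simp [supp, hMac]
    have s4 : supp M c a = 0 := by simp [supp, hMca]
    unfold swapMatching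
    by_cases hka : k = a
    · subst hka
      rw [s4, s1, if_neg hac.ne, if_pos rfl]
      simp only [supp, hNa]
      ring
    by_cases hkc : k = c
    · subst hkc
      rw [s2, s3, if_neg hac.ne', if_pos rfl]
      simp only [supp, hNc]
      ring
    rw [if_neg hka, if_neg hkc]
    by_cases hla : l = a
    · subst hla
      rw [s1, s4, if_neg hac.ne, if_pos rfl, hs k l]
      have : N k l = 0 := by
        by_contra h; exact (hNo k l hka hkc h).1 rfl
      simp [supp, this]
    by_cases hlc : l = c
    · subst hlc
      rw [s2, s3, if_neg hla, if_pos rfl, hs k l]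
      have : N k l = 0 := by
        by_contra h; exact (hNo k l hka hkc h).2 rfl
      simp [supp, this]
    rw [if_neg hla, if_neg hlc, hs c k, hs a k]
    simp only [supp, hcase k l hka hkc hla hlc]
    have r := hM.row k
    by_cases e1 : M k l = 0
    · by_cases e2 : M k a = 0
      · by_cases e3 : M k c = 0 <;> by_cases e4 : M a l = 0 <;> simp [e1, e2, e3, e4]
      · have e3 : M k c = 0 := by
          by_contra h; exact hac.ne (r _ _ e2 h)
        by_cases e4 : M c l = 0 <;> simp [e1, e2, e3, e4]
    · have e2 : M k a = 0 := by
        by_contra h; exact hla (r _ _ e1 h)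
      have e3 : M k c = 0 := by
        by_contra h; exact hlc (r _ _ e1 h)
      simp [e1, e2, e3]
  rw [← hg.cornerRk_conj A, ← hN, hNmono.cornerRk_eq, hsupp]

lemma tendsto_add_skewUnit (M : Matrix (Fin n) (Fin n) ℂ) (a c : Fin n) :
    Tendsto (fun t : ℂ => M + skewUnit a c t) (𝓝[≠] 0) (𝓝 M) := by
  have hcont : Continuous fun t : ℂ => M + skewUnit a c t := by
    refine continuous_const.add (continuous_matrix fun k l => ?_)
    unfold skewUnit
    split_ifs <;> fun_prop
  have h0 : M + skewUnit a c 0 = M := by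
    ext k l; simp [skewUnit]
  have := hcont.tendsto 0
  rw [h0] at this
  exact this.mono_left nhdsWithin_le_nhds

/-- A skew-symmetric matrix with corner ranks at most those of `z` is a limit of skew-symmetric
matrices with exactly those corner ranks. -/
lemma mem_closure_rankLocus {z : Equiv.Perm (Fin n)} (hz : Function.Involutive z)
    (hfpf : ∀ i, z i ≠ i) :
    ∀ (m : ℕ) (A : Matrix (Fin n) (Fin n) ℂ), (∀ i j, A i j = -A j i) →
      (∀ p q, (cornerRk A p q : ℤ) ≤ cornerSum (permInd z) p q) →
      ∑ x : Fin n × Fin n, (cornerSum (permInd z) (x.1 + 1) (x.2 + 1) -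
        cornerRk A (x.1 + 1) (x.2 + 1)) < m →
      A ∈ closure (rankLocus z) := by
  intro m
  induction m with
  | zero =>
    intro A hA hle hm
    refine absurd hm (not_lt.2 (Finset.sum_nonneg fun x _ => ?_))
    have := hle (x.1 + 1) (x.2 + 1)
    omega
  | succ m ih =>
    intro A hA hle hm
    obtain ⟨g, hg, hM⟩ := exists_isMono hA
    obtain ⟨M, hMe⟩ : ∃ M, M = g * A * gᵀ := ⟨_, rfl⟩
    apply mem_closure_rankLocus_of_conj hg
    have hrk : ∀ p q, cornerRk A p q = cornerRk M p q := fun p q => by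
      rw [hMe, hg.cornerRk_conj]
    rw [← hMe] at hM ⊢
    simp only [hrk] at hle hm
    simp only [hM.cornerRk_eq] at hle hm
    by_cases hne : supp M = permInd z
    · apply subset_closure
      exact ⟨hM.skew, fun p q => by rw [hM.cornerRk_eq, hne]⟩
    obtain ⟨a, c, hac, ha, hc, h1, h2, h3⟩ :=
      exists_swapMatching_le hz hfpf hM.isMatching hle hne
    have hsupp0 : ∀ k l, supp M k l = 0 → M k l = 0 := by
      intro k l h
      by_contra h'
      simp [supp, h'] at h
    -- For `t ≠ 0` the perturbed matrix has smaller total deficiency, hence lies in the closure by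
    -- induction; let `t → 0`.
    refine isClosed_closure.mem_of_tendsto (tendsto_add_skewUnit M a c) ?_
    filter_upwards [self_mem_nhdsWithin] with t ht
    obtain ⟨hs, hr⟩ := hM.cornerRk_add_skewUnit hac (fun l hl => hsupp0 _ _ (ha l hl))
      (fun l hl => hsupp0 _ _ (hc l hl)) ht
    refine ih _ hs (fun p q => by rw [hr]; exact h2 p q) ?_
    have hlt : ∑ x : Fin n × Fin n, (cornerSum (permInd z) (x.1 + 1) (x.2 + 1) -
        cornerRk (M + skewUnit a c t) (x.1 + 1) (x.2 + 1)) <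
        ∑ x : Fin n × Fin n, (cornerSum (permInd z) (x.1 + 1) (x.2 + 1) -
        cornerSum (supp M) (x.1 + 1) (x.2 + 1)) := by
      refine Finset.sum_lt_sum (fun x _ => ?_) ⟨(a, c), Finset.mem_univ _, ?_⟩
      · rw [hr]
        have := h1 (x.1 + 1) (x.2 + 1)
        omega
      · rw [hr]
        simp only
        omega
    push_cast at hm
    omega

end closure

/-! ## Coordinates -/

section coordinates

variable {n : ℕ}

lemma rank_submatrix_Iic (A : Matrix (Fin n) (Fin n) ℂ) (i j : Fin n) :
    (A.submatrix (fun k : Set.Iic i => (k : Fin n)) (fun l : Set.Iic j => (l : Fin n))).rank =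
      cornerRk A (i + 1) (j + 1) := by
  have e : ∀ i : Fin n, ∀ k : Fin n, k ∈ Set.Iic i ↔ (k : ℕ) < i + 1 := fun i k => by
    rw [Set.mem_Iic, Fin.le_def, Nat.lt_succ_iff]
  exact (Matrix.rank_submatrix (A.submatrix
    (Subtype.val : {k : Fin n // (k : ℕ) < i + 1} → Fin n)
    (Subtype.val : {l : Fin n // (l : ℕ) < j + 1} → Fin n))
    (Equiv.subtypeEquivRight (e i)) (Equiv.subtypeEquivRight (e j)))

lemma cornerRk_self (A : Matrix (Fin n) (Fin n) ℂ) : cornerRk A n n = A.rank :=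
  Matrix.rank_submatrix A (Equiv.subtypeUnivEquiv fun k => k.2)
    (Equiv.subtypeUnivEquiv fun k => k.2)

lemma cornerRank_eq (w : Equiv.Perm (Fin n)) (i j : Fin n) :
    (cornerRank w i j : ℤ) = cornerSum (permInd w) (i + 1) (j + 1) := by
  have hne : ∀ k l, w.permMatrix ℂ k l ≠ 0 ↔ w k = l := by
    intro k l
    rw [Equiv.Perm.permMatrix, PEquiv.toMatrix_apply]
    simp [eq_comm]
  have hsupp : supp (w.permMatrix ℂ) = permInd w := by
    funext k l
    simp only [supp, permInd, hne]
  unfold cornerRank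
  rw [rank_submatrix_Iic, cornerRk_of_unique, hsupp]
  · intro i j l h1 h2
    rw [hne] at h1 h2
    rw [← h1, h2]
  · intro i k j h1 h2
    rw [hne] at h1 h2
    exact w.injective (h1.trans h2.symm)

/-- The map `ℂⁿ → (ℂⁿ)*` with matrix `A` in the basis `b`. -/
def toDualMap (b : Basis (Fin n) ℂ (V n)) (A : Matrix (Fin n) (Fin n) ℂ) :
    V n →ₗ[ℂ] Dual ℂ (V n) :=
  Matrix.toLin b b.dualBasis A

lemma toDualMap_apply (b : Basis (Fin n) ℂ (V n)) (A : Matrix (Fin n) (Fin n) ℂ) (k l : Fin n) :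
    toDualMap b A (b l) (b k) = A k l := by
  rw [← b.dualBasis_repr, toDualMap, ← LinearMap.toMatrix_apply, LinearMap.toMatrix_toLin]

lemma toDualMap_of (b : Basis (Fin n) ℂ (V n)) (f : V n →ₗ[ℂ] Dual ℂ (V n)) :
    toDualMap b (Matrix.of fun k l => f (b l) (b k)) = f :=
  b.ext fun l => b.ext fun k => toDualMap_apply b _ k l

lemma isSkew_toDualMap (b : Basis (Fin n) ℂ (V n)) {A : Matrix (Fin n) (Fin n) ℂ}
    (hA : ∀ i j, A i j = -A j i) : IsSkew (toDualMap b A) := by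
  have : toDualMap b A = -(toDualMap b A).flip :=
    b.ext fun l => b.ext fun k => by
      rw [LinearMap.neg_apply, LinearMap.neg_apply, LinearMap.flip_apply, toDualMap_apply,
        toDualMap_apply, hA]
  intro v w
  exact congrArg (fun g : V n →ₗ[ℂ] Dual ℂ (V n) => g v w) this

lemma bijective_toDualMap (b : Basis (Fin n) ℂ (V n)) {A : Matrix (Fin n) (Fin n) ℂ}
    (hA : A.rank = n) : Function.Bijective (toDualMap b A) := by
  have hs : Function.Surjective (toDualMap b A) := by
    rw [← LinearMap.range_eq_top]
    apply Submodule.eq_top_of_finrank_eq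
    rw [toDualMap, ← Matrix.rank_eq_finrank_range_toLin, hA]
    simp
  exact ⟨(LinearMap.injective_iff_surjective_of_finrank_eq_finrank (by simp)).2 hs, hs⟩

lemma rankBetween_toFl (v : FlFrame n) (f : V n →ₗ[ℂ] Dual ℂ (V n)) (i j : Fin n) :
    rankBetween f (v.toFl.E j) (v.toFl.E i) =
      cornerRk (Matrix.of fun k l => f (v.1 l) (v.1 k)) (i + 1) (j + 1) := by
  have hli : ∀ i : Fin n, LinearIndependent ℂ (fun k : Set.Iic i => v.1 k) := fun i =>
    v.2.comp (fun k : Set.Iic i => (k : Fin n)) Subtype.val_injective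
  let bi : Basis (Set.Iic i) ℂ (v.toFl.E i) := Basis.span (hli i)
  let bj : Basis (Set.Iic j) ℂ (v.toFl.E j) := Basis.span (hli j)
  rw [← rank_submatrix_Iic]
  have hbi : ∀ k, (bi k : V n) = v.1 k := fun k =>
    congrArg Subtype.val (Basis.span_apply (hli i) k)
  have hbj : ∀ k, (bj k : V n) = v.1 k := fun k =>
    congrArg Subtype.val (Basis.span_apply (hli j) k)
  rw [Matrix.rank_eq_finrank_range_toLin _ bi.dualBasis bj]
  unfold rankBetween
  have : Matrix.toLin bj bi.dualBasis
      (Matrix.submatrix (Matrix.of fun k l => f (v.1 l) (v.1 k)) (fun k : Set.Iic i => (k : Fin n))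
        (fun l : Set.Iic j => (l : Fin n))) =
      (v.toFl.E i).subtype.dualMap ∘ₗ f ∘ₗ (v.toFl.E j).subtype := by
    rw [← (LinearMap.toMatrix bj bi.dualBasis).injective.eq_iff, LinearMap.toMatrix_toLin]
    ext k l
    rw [LinearMap.toMatrix_apply, Basis.dualBasis_repr]
    change f (v.1 l) (v.1 k) = f (bj l) (bi k)
    rw [hbi, hbj]
  rw [this]

/-- Pick each `v i` in `E i` outside the previous step `G i` of the flag (`⊥` at the start). In a
linear relation the last nonzero coefficient would put its vector into `G i`. -/
lemma exists_flFrame (F : Fl n) : ∃ b : Basis (Fin n) ℂ (V n),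
    FlFrame.toFl ⟨b, b.linearIndependent⟩ = F := by
  classical
  have hG : ∀ i : Fin n, ∃ G : Submodule ℂ (V n), finrank ℂ G = i ∧ ∀ j < i, F.E j ≤ G := by
    intro i
    by_cases hi : (i : ℕ) = 0
    · refine ⟨⊥, by simp [hi], fun j hj => ?_⟩
      rw [Fin.lt_def] at hj; omega
    · refine ⟨F.E ⟨i - 1, by omega⟩, ?_, fun j hj => F.mono ?_⟩
      · rw [F.finrank_E]; simp only; omega
      · rw [Fin.le_def]; rw [Fin.lt_def] at hj; simp only; omega
  choose G hGr hG using hG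
  have hx : ∀ i, ∃ x ∈ F.E i, x ∉ G i := by
    intro i
    by_contra! h
    have := Submodule.finrank_mono (show F.E i ≤ G i from h)
    rw [F.finrank_E, hGr] at this
    omega
  choose v hv hvG using hx
  have hli : LinearIndependent ℂ v := by
    rw [Fintype.linearIndependent_iff]
    intro c hc
    by_contra! hne
    obtain ⟨i, hi, hmax⟩ := Finset.exists_max_image (Finset.univ.filter fun i => c i ≠ 0) id
      (by obtain ⟨i, hi⟩ := hne; exact ⟨i, by simpa using hi⟩)
    simp only [Finset.mem_filter, Finset.mem_univ, true_and, id] at hi hmax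
    rw [← Finset.add_sum_erase _ _ (Finset.mem_univ i)] at hc
    have h1 : ∑ j ∈ Finset.univ.erase i, c j • v j ∈ G i := by
      refine Submodule.sum_mem _ fun j hj => ?_
      rcases lt_or_gt_of_ne (Finset.ne_of_mem_erase hj) with h | h
      · exact Submodule.smul_mem _ _ (hG i j h (hv j))
      · have : c j = 0 := by
          by_contra h2; exact (hmax j h2).not_gt h
        rw [this, zero_smul]; exact Submodule.zero_mem _
    have h2 : c i • v i ∈ G i := by
      rw [eq_neg_of_add_eq_zero_left hc]
      exact Submodule.neg_mem _ h1
    exact hvG i ((Submodule.smul_mem_iff _ hi).1 h2)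
  refine ⟨basisOfPiSpaceOfLinearIndependent hli, ?_⟩
  ext1
  funext i
  apply Submodule.eq_of_le_of_finrank_eq
  · refine Submodule.span_le.2 ?_
    rintro _ ⟨k, rfl⟩
    change basisOfPiSpaceOfLinearIndependent hli k ∈ F.E i
    rw [coe_basisOfPiSpaceOfLinearIndependent]
    exact F.mono k.2 (hv k)
  · rw [Fl.finrank_E, Fl.finrank_E]

/-- The frame `(b_k, f(b_k))` of the graph of `f`. -/
def graphFrame (b : Basis (Fin n) ℂ (V n)) (f : V n →ₗ[ℂ] Dual ℂ (V n)) : GrFrame n :=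
  ⟨fun k => (b k, f (b k)), by
    apply LinearIndependent.of_comp (LinearMap.fst ℂ (V n) (Dual ℂ (V n)))
    exact b.linearIndependent⟩

lemma finrank_graph (f : V n →ₗ[ℂ] Dual ℂ (V n)) : finrank ℂ f.graph = n := by
  rw [LinearMap.graph_eq_range_prod, LinearMap.finrank_range_of_inj]
  · simp
  · intro x y h
    exact congrArg Prod.fst h

lemma toGr_graphFrame (b : Basis (Fin n) ℂ (V n)) (f : V n →ₗ[ℂ] Dual ℂ (V n)) :
    (graphFrame b f).toGr.space = f.graph := by
  apply Submodule.eq_of_le_of_finrank_eq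
  · refine Submodule.span_le.2 ?_
    rintro _ ⟨k, rfl⟩
    rfl
  · rw [Gr.finrank_space, finrank_graph]

end coordinates

/-! ## Zariski closed sets -/

section zariski

open Topology

variable {n : ℕ}

lemma isClosed_zariskiAffine_iff {σ : Type} {K : Set (σ → ℂ)} :
    IsClosed[zariskiAffine σ] K ↔
      ∃ s : Set (MvPolynomial σ ℂ), K = {x | ∀ q ∈ s, MvPolynomial.eval x q = 0} := by
  have key : ∀ s : Set (MvPolynomial σ ℂ),
      MvPolynomial.pointToPoint (k := ℂ) (K := ℂ) ⁻¹' PrimeSpectrum.zeroLocus s =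
        {x : σ → ℂ | ∀ q ∈ s, MvPolynomial.eval x q = 0} := by
    intro s
    ext x
    simp only [Set.mem_preimage, PrimeSpectrum.mem_zeroLocus, Set.subset_def, Set.mem_ofPred_eq]
    refine forall₂_congr fun q _ => ?_
    exact MvPolynomial.mem_vanishingIdeal_singleton_iff x q
  constructor
  · intro h
    obtain ⟨t, ht, rfl⟩ := (isClosed_induced_iff (f := MvPolynomial.pointToPoint)).1 h
    obtain ⟨s, rfl⟩ := (PrimeSpectrum.isClosed_iff_zeroLocus t).1 ht
    exact ⟨s, key s⟩
  · rintro ⟨s, rfl⟩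
    exact (isClosed_induced_iff (f := MvPolynomial.pointToPoint)).2
      ⟨_, PrimeSpectrum.isClosed_zeroLocus s, key s⟩

/-- Closed sets for the quotient of a space of frames with coordinates in affine space. -/
lemma isClosed_coinduced_zariskiAffine_iff {X Y σ : Type} (c : X → σ → ℂ) (π : X → Y)
    {K : Set Y} :
    IsClosed[TopologicalSpace.coinduced π (TopologicalSpace.induced c (zariskiAffine σ))] K ↔
      ∃ s : Set (MvPolynomial σ ℂ), ∀ x, π x ∈ K ↔ ∀ q ∈ s, MvPolynomial.eval (c x) q = 0 := by
  rw [isClosed_coinduced, @isClosed_induced_iff _ _ (zariskiAffine σ)]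
  constructor
  · rintro ⟨t, ht, h⟩
    obtain ⟨s, rfl⟩ := isClosed_zariskiAffine_iff.1 ht
    exact ⟨s, fun x => (Set.ext_iff.1 h x).symm⟩
  · rintro ⟨s, hs⟩
    exact ⟨_, isClosed_zariskiAffine_iff.2 ⟨s, rfl⟩, Set.ext fun x => (hs x).symm⟩

lemma isClosed_gr_iff {K : Set (Gr n)} : IsClosed K ↔
    ∃ s : Set (MvPolynomial (Fin n × (Fin n ⊕ Fin n)) ℂ),
      ∀ u : GrFrame n, u.toGr ∈ K ↔ ∀ q ∈ s, MvPolynomial.eval u.coord q = 0 :=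
  isClosed_coinduced_zariskiAffine_iff _ _

lemma isClosed_grFl_iff {K : Set (GrFl n)} : IsClosed K ↔
    ∃ s : Set (MvPolynomial ((Fin n × (Fin n ⊕ Fin n)) ⊕ (Fin n × Fin n)) ℂ),
      ∀ x : GrFrame n × FlFrame n, (⟨x.1.toGr, x.2.toFl⟩ : GrFl n) ∈ K ↔
        ∀ q ∈ s, MvPolynomial.eval (Sum.elim x.1.coord x.2.coord) q = 0 :=
  isClosed_coinduced_zariskiAffine_iff _ _

/-- The pairs with a graph, over a fixed flag, depend continuously on the matrix of the map. -/
lemma isClosed_setOf_graphFrame (b : Basis (Fin n) ℂ (V n)) (v : FlFrame n) {K : Set (GrFl n)}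
    (hK : IsClosed K) : IsClosed {A : Matrix (Fin n) (Fin n) ℂ |
      (⟨(graphFrame b (toDualMap b A)).toGr, v.toFl⟩ : GrFl n) ∈ K} := by
  obtain ⟨s, hs⟩ := isClosed_grFl_iff.1 hK
  have : {A : Matrix (Fin n) (Fin n) ℂ |
      (⟨(graphFrame b (toDualMap b A)).toGr, v.toFl⟩ : GrFl n) ∈ K} =
      ⋂ q ∈ s, {A | MvPolynomial.eval
        (Sum.elim (graphFrame b (toDualMap b A)).coord v.coord) q = 0} := by
    ext A
    simp only [Set.mem_ofPred_eq, Set.mem_iInter]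
    exact hs (graphFrame b (toDualMap b A), v)
  rw [this]
  -- The frame coordinates are constant or linear in `A`, and polynomials are continuous for the
  -- Euclidean topology.
  refine isClosed_biInter fun q _ => isClosed_eq ?_ continuous_const
  refine (MvPolynomial.continuous_eval q).comp (continuous_pi fun c => ?_)
  rcases c with ⟨k, i | i⟩ | c
  · exact continuous_const
  · exact LinearMap.continuous_of_finiteDimensional
      ((LinearMap.applyₗ (Pi.single i 1 : V n)) ∘ₗ (LinearMap.applyₗ (b k)) ∘ₗ
        (Matrix.toLin b b.dualBasis).toLinearMap)
  · exact continuous_const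

/-- The planes which are graphs form an open subset. -/
lemma isOpen_setOf_graph :
    IsOpen {U : Gr n | ∃ f : V n →ₗ[ℂ] Dual ℂ (V n), U.space = f.graph} := by
  rw [← isClosed_compl_iff, isClosed_gr_iff]
  -- A plane is a graph exactly when its projection to `ℂⁿ` is bijective, that is, when this minor
  -- of a frame is nonzero.
  let D : Matrix (Fin n) (Fin n) (MvPolynomial (Fin n × (Fin n ⊕ Fin n)) ℂ) :=
    Matrix.of fun k i => MvPolynomial.X (k, Sum.inl i)
  refine ⟨{D.det}, fun u => ?_⟩
  have hdet : MvPolynomial.eval u.coord D.det =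
      (Matrix.of fun k => (u.1 k).1 : Matrix (Fin n) (Fin n) ℂ).det := by
    rw [RingHom.map_det]
    congr 1
    ext k i
    simp [D, GrFrame.coord]
  simp only [Set.mem_singleton_iff, forall_eq, hdet]
  rw [Set.mem_compl_iff, Set.mem_ofPred_eq, not_iff_comm, ← ne_eq, ← isUnit_iff_ne_zero,
    ← Matrix.isUnit_iff_isUnit_det, ← Matrix.linearIndependent_rows_iff_isUnit]
  change LinearIndependent ℂ (fun k => (u.1 k).1) ↔ _
  classical
  constructor
  · intro h
    let b := basisOfPiSpaceOfLinearIndependent h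
    have hb : ∀ k, b k = (u.1 k).1 := fun k => by
      simp only [b, coe_basisOfPiSpaceOfLinearIndependent]
    refine ⟨b.constr ℂ fun k => (u.1 k).2, ?_⟩
    apply Submodule.eq_of_le_of_finrank_eq
    · refine Submodule.span_le.2 ?_
      rintro _ ⟨k, rfl⟩
      change (u.1 k).2 = b.constr ℂ (fun k => (u.1 k).2) (u.1 k).1
      rw [← hb, Basis.constr_basis]
    · rw [Gr.finrank_space, finrank_graph]
  · rintro ⟨f, hf⟩
    have hmem : ∀ k, (u.1 k).2 = f (u.1 k).1 := fun k => by
      have : u.1 k ∈ u.toGr.space := Submodule.subset_span ⟨k, rfl⟩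
      rw [hf] at this
      exact this
    have hu : u.1 = (LinearMap.id.prod f) ∘ fun k => (u.1 k).1 := by
      funext k
      exact Prod.ext rfl (hmem k)
    have h2 := u.2
    rw [hu] at h2
    exact LinearIndependent.of_comp _ h2

/-- Graphs of skew-symmetric maps lie in the orthogonal Grassmannian. -/
lemma mem_OG_of_graph {U : Gr n} {f : V n →ₗ[ℂ] Dual ℂ (V n)} (hf : IsSkew f)
    (hU : U.space = f.graph) : U ∈ OG n := by
  let O : Set (Isotropic n) := {U | ∃ f : V n →ₗ[ℂ] Dual ℂ (V n), U.1.space = f.graph}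
  have hO : IsOpen O := isOpen_setOf_graph.preimage continuous_subtype_val
  let e := Pi.basisFun ℂ (Fin n)
  -- the parametrization of graphs by matrices
  let Θ : (Fin n × Fin n → ℂ) → GrFrame n := fun B =>
    graphFrame e (toDualMap e (Matrix.of fun k l => B (k, l) - B (l, k)))
  have hskew : ∀ B : Fin n × Fin n → ℂ,
      IsSkew (toDualMap e (Matrix.of fun k l => B (k, l) - B (l, k))) :=
    fun B => isSkew_toDualMap e fun i j => by simp
  have hiso : ∀ (g : V n →ₗ[ℂ] Dual ℂ (V n)), IsSkew g → ∀ x ∈ g.graph, ∀ y ∈ g.graph,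
      formPlus x y = 0 := by
    intro g hg x hx y hy
    rw [LinearMap.mem_graph_iff] at hx hy
    rw [formPlus, hx, hy, hg x.1 y.1, neg_add_cancel]
  have hΘmem : ∀ B, ∃ U : Isotropic n, U.1 = (Θ B).toGr ∧ U ∈ O := by
    intro B
    refine ⟨⟨(Θ B).toGr, ?_⟩, rfl, _, toGr_graphFrame _ _⟩
    rw [toGr_graphFrame]
    exact hiso _ (hskew B)
  have hΘsurj : ∀ U ∈ O, ∃ B, U.1 = (Θ B).toGr := by
    rintro U ⟨g, hg⟩
    have hgs : IsSkew g := by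
      intro v w
      have h1 : (v, g v) ∈ U.1.space := by rw [hg]; rfl
      have h2 : (w, g w) ∈ U.1.space := by rw [hg]; rfl
      exact eq_neg_of_add_eq_zero_left (U.2 _ h1 _ h2)
    refine ⟨fun x => g (e x.2) (e x.1) / 2, ?_⟩
    ext1
    rw [toGr_graphFrame, hg]
    congr 1
    rw [← toDualMap_of e g]
    congr 1
    funext k l
    rw [toDualMap_of]
    simp only [Matrix.of_apply]
    rw [hgs (e k) (e l)]
    ring
  let P : Fin n × (Fin n ⊕ Fin n) → MvPolynomial (Fin n × Fin n) ℂ := fun c =>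
    Sum.elim (fun i => MvPolynomial.C (e c.1 i))
      (fun i => MvPolynomial.X (i, c.1) - MvPolynomial.X (c.1, i)) c.2
  have hP : ∀ B q, MvPolynomial.eval (Θ B).coord q =
      MvPolynomial.eval B (MvPolynomial.bind₁ P q) := by
    intro B q
    have h := MvPolynomial.aeval_bind₁ B P q
    simp only [MvPolynomial.aeval_eq_eval] at h
    have hc : (Θ B).coord = fun i => MvPolynomial.eval B (P i) := by
      rw [funext_iff]
      rintro ⟨k, i | i⟩
      · simp [P, Θ, GrFrame.coord, graphFrame]
      · have : (Pi.single i 1 : V n) = e i := by simp [e]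
        simp only [GrFrame.coord, Θ, graphFrame, Sum.elim_inr, this, toDualMap_apply]
        simp [P]
    rw [hc]
    exact h.symm
  have hirr : IsPreirreducible O := by
    rw [isPreirreducible_iff_isClosed_union_isClosed]
    intro z₁ z₂ h₁ h₂ hsub
    obtain ⟨K₁, hK₁, rfl⟩ := isClosed_induced_iff.1 h₁
    obtain ⟨K₂, hK₂, rfl⟩ := isClosed_induced_iff.1 h₂
    obtain ⟨s₁, hs₁⟩ := isClosed_gr_iff.1 hK₁
    obtain ⟨s₂, hs₂⟩ := isClosed_gr_iff.1 hK₂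
    by_contra! hcon
    obtain ⟨hc₁, hc₂⟩ := hcon
    have hne : ∀ (K : Set (Gr n)) (s : Set (MvPolynomial (Fin n × (Fin n ⊕ Fin n)) ℂ)),
        (∀ u : GrFrame n, u.toGr ∈ K ↔ ∀ q ∈ s, MvPolynomial.eval u.coord q = 0) →
        ¬ O ⊆ Subtype.val ⁻¹' K → ∃ q ∈ s, MvPolynomial.bind₁ P q ≠ 0 := by
      intro K s hs hK
      obtain ⟨U, hUO, hUK⟩ := Set.not_subset.1 hK
      obtain ⟨B, hB⟩ := hΘsurj U hUO
      rw [Set.mem_preimage, hB, hs] at hUK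
      push Not at hUK
      obtain ⟨q, hq, hqB⟩ := hUK
      refine ⟨q, hq, fun h => hqB ?_⟩
      rw [hP, h, map_zero]
    obtain ⟨q₁, hq₁, hn₁⟩ := hne K₁ s₁ hs₁ hc₁
    obtain ⟨q₂, hq₂, hn₂⟩ := hne K₂ s₂ hs₂ hc₂
    obtain ⟨B, hB⟩ : ∃ B, MvPolynomial.eval B
        (MvPolynomial.bind₁ P q₁ * MvPolynomial.bind₁ P q₂) ≠ 0 := by
      by_contra! h
      exact mul_ne_zero hn₁ hn₂ (MvPolynomial.funext fun x => by rw [h x, map_zero])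
    rw [map_mul, ← hP, ← hP] at hB
    obtain ⟨U, hU, hUO⟩ := hΘmem B
    rcases hsub hUO with h | h
    · rw [Set.mem_preimage, hU, hs₁] at h
      exact hB (by rw [h q₁ hq₁, zero_mul])
    · rw [Set.mem_preimage, hU, hs₂] at h
      exact hB (by rw [h q₂ hq₂, mul_zero])
  have hbase : isotropicBase n ∈ O := by
    refine ⟨0, ?_⟩
    change LinearMap.range (LinearMap.inl ℂ (V n) (Dual ℂ (V n))) = _
    ext x
    simp only [LinearMap.mem_range, LinearMap.inl_apply, LinearMap.mem_graph_iff,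
      LinearMap.zero_apply]
    exact ⟨fun ⟨y, hy⟩ => by rw [← hy], fun h => ⟨x.1, Prod.ext rfl h.symm⟩⟩
  -- A nonempty open part of an irreducible set is dense in it. As `closure O` is itself
  -- irreducible, maximality makes it equal to the component.
  have hsub : irreducibleComponent (isotropicBase n) ⊆ closure O :=
    (subset_closure_inter_of_isPreirreducible_of_isOpen
      (isIrreducible_irreducibleComponent).2 hO
      ⟨_, mem_irreducibleComponent, hbase⟩).trans (closure_mono Set.inter_subset_right)
  have heq := eq_irreducibleComponent hirr.closure hsub
  have hUiso : ∀ x ∈ U.space, ∀ y ∈ U.space, formPlus x y = 0 := by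
    rw [hU]; exact hiso f hf
  refine ⟨⟨U, hUiso⟩, ?_, rfl⟩
  rw [← heq]
  exact subset_closure ⟨f, hU⟩

end zariski

/-! ## Closures in the product of the orthogonal Grassmannian and the flag variety -/

section main

open Topology

variable {n : ℕ}

/-- The matrix of a point of `OGFl` with a graph of a skew map, in a basis adapted to the flag. -/
lemma exists_matrix {p : OGFl n} {f : V n →ₗ[ℂ] Dual ℂ (V n)} (hf : IsSkew f)
    (hp : p.1.U.space = f.graph) :
    ∃ (b : Basis (Fin n) ℂ (V n)) (A : Matrix (Fin n) (Fin n) ℂ), (∀ i j, A i j = -A j i) ∧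
      p.1 = ⟨(graphFrame b (toDualMap b A)).toGr, FlFrame.toFl ⟨b, b.linearIndependent⟩⟩ ∧
      ∀ i j, rankBetween f (p.1.flag.E j) (p.1.flag.E i) = cornerRk A (i + 1) (j + 1) := by
  obtain ⟨b, hb⟩ := exists_flFrame p.1.flag
  refine ⟨b, Matrix.of fun k l => f (b l) (b k), fun i j => hf _ _, ?_, fun i j => ?_⟩
  · ext1
    · ext1
      rw [hp, toGr_graphFrame, toDualMap_of]
    · exact hb.symm
  · rw [← hb, rankBetween_toFl]

lemma mem_OGX_of_mem_rankLocus {z : Equiv.Perm (Fin n)} {A : Matrix (Fin n) (Fin n) ℂ}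
    (b : Basis (Fin n) ℂ (V n)) (hA : A ∈ rankLocus z) :
    ∃ p ∈ OGX z,
      p.1 = ⟨(graphFrame b (toDualMap b A)).toGr, FlFrame.toFl ⟨b, b.linearIndependent⟩⟩ := by
  have hskew := isSkew_toDualMap b hA.1
  have hgr := toGr_graphFrame b (toDualMap b A)
  refine ⟨⟨_, mem_OG_of_graph hskew hgr⟩, ⟨toDualMap b A, hskew, ?_, hgr, fun i j => ?_⟩, rfl⟩
  -- The full corner of the permutation `z` has rank `n`, so invertibility is automatic.
  · apply bijective_toDualMap
    have h := hA.2 n n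
    rw [cornerRk_self, cornerSum_permInd] at h
    simpa using h
  · rw [rankBetween_toFl]
    have h := hA.2 (i + 1) (j + 1)
    rw [← cornerRank_eq] at h
    rw [← Int.natCast_inj, ← h]
    congr 2
    ext k l
    exact toDualMap_apply b A k l

/-- Points with skew matrices that are limits of a rank locus lie in the closure of `OGX z`. -/
lemma mem_closure_OGX {z : Equiv.Perm (Fin n)} {A : Matrix (Fin n) (Fin n) ℂ}
    {b : Basis (Fin n) ℂ (V n)} (hA : A ∈ closure (rankLocus z)) {p : OGFl n}
    (hp : p.1 = ⟨(graphFrame b (toDualMap b A)).toGr,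
      FlFrame.toFl ⟨b, b.linearIndependent⟩⟩) :
    p ∈ closure (OGX z) := by
  obtain ⟨K, hK, hKe⟩ := isClosed_induced_iff.1 (isClosed_closure (s := OGX z))
  rw [← hKe, Set.mem_preimage, hp]
  refine closure_minimal ?_
    (isClosed_setOf_graphFrame b ⟨b, b.linearIndependent⟩ hK) hA
  intro B hB
  obtain ⟨q, hq, hqe⟩ := mem_OGX_of_mem_rankLocus b hB
  have : q ∈ Subtype.val ⁻¹' K := by rw [hKe]; exact subset_closure hq
  rw [Set.mem_preimage, hqe] at this
  exact this

lemma isMatching_cornerRk {A : Matrix (Fin n) (Fin n) ℂ} (hA : ∀ i j, A i j = -A j i) :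
    ∃ ι : Fin n → Fin n → ℤ, IsMatching ι ∧ ∀ p q, (cornerRk A p q : ℤ) = cornerSum ι p q := by
  obtain ⟨g, hg, hM⟩ := exists_isMono hA
  exact ⟨_, hM.isMatching, fun p q => by rw [← hg.cornerRk_conj A, hM.cornerRk_eq]⟩

/-- If the corner ranks of `y` and `z` agree on the essential set of `y`, and the rank bounds on
that set imply those given by `z`, then `OGX z` and `OGXess y` have the same closure. -/
lemma closure_OGX_eq {z y : Equiv.Perm (Fin n)} (hz : Function.Involutive z)
    (hfpf : ∀ i, z i ≠ i)
    (heq : ∀ i j : Fin n, ((i : ℕ), (j : ℕ)) ∈ Ess (rotheSp y) →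
      cornerSum (permInd y) (i + 1) (j + 1) = cornerSum (permInd z) (i + 1) (j + 1))
    (hle : ∀ ι : Fin n → Fin n → ℤ, IsMatching ι →
      (∀ i j : Fin n, ((i : ℕ), (j : ℕ)) ∈ Ess (rotheSp y) →
        cornerSum ι (i + 1) (j + 1) ≤ cornerSum (permInd y) (i + 1) (j + 1)) →
      ∀ i j : Fin n, ((i : ℕ), (j : ℕ)) ∈ rotheSp z →
        cornerSum ι (i + 1) (j + 1) ≤ cornerSum (permInd z) (i + 1) (j + 1)) :
    closure (OGX z) = closure (OGXess y) := by
  apply subset_antisymm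
  · apply closure_mono
    rintro p ⟨f, hf, -, hp, hr⟩
    refine ⟨f, hf, hp, fun i j hij => ?_⟩
    rw [hr, ← Int.natCast_inj, cornerRank_eq, cornerRank_eq, heq i j hij]
  · apply closure_minimal _ isClosed_closure
    rintro p ⟨f, hf, hp, hr⟩
    obtain ⟨b, A, hA, hpe, hrk⟩ := exists_matrix hf hp
    obtain ⟨ι, hι, hAι⟩ := isMatching_cornerRk hA
    -- The induction bound is one more than the total deficiency, converted to a natural number.
    refine mem_closure_OGX (mem_closure_rankLocus hz hfpf _ A hA (fun p q => ?_)
      ((lt_add_one _).trans_le (Int.self_le_toNat _))) hpe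
    rw [hAι]
    refine le_of_le_on_rotheSp hz hfpf hι (hle ι hι fun i j hij => ?_) _ p q le_rfl
    have h := hAι (i + 1) (j + 1)
    rw [← h, ← hrk, hr i j hij, cornerRank_eq]

end main

end OrthGraph

end

theorem mainTheorem9 (n : ℕ) (z : Equiv.Perm (Fin n)) (hz : Function.Involutive z)
    (hfpf : ∀ i, z i ≠ i) :
    closure (OrthGraph.OGX z) = closure (OrthGraph.OGXess z) ∧
    closure (OrthGraph.OGXess z) = closure (OrthGraph.OGXess (OrthGraph.dearcL z hz)) ∧
    closure (OrthGraph.OGXess z) = closure (OrthGraph.OGXess (OrthGraph.dearcR z hz)) := by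
  open OrthGraph in
  have h1 : closure (OGX z) = closure (OGXess z) :=
    closure_OGX_eq hz hfpf (fun i j _ => rfl) fun ι hι h i j hij =>
      le_on_rotheSp_of_le_on_ess hz hι.nonneg h (2 * n) i j (by omega) hij
  have h2 : closure (OGX z) = closure (OGXess (dearcL z hz)) := by
    refine closure_OGX_eq hz hfpf (fun i j hij => ?_) fun ι hι h i j hij => ?_
    · rw [rotheSp_dearcL hz hfpf] at hij
      exact cornerSum_dearcL hz hfpf hij.1
    · rw [← cornerSum_dearcL hz hfpf hij]
      refine le_on_rotheSp_of_le_on_ess (keepArcs_involutive hz _) hι.nonneg h (2 * n) i j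
        (by omega) ?_
      change _ ∈ rotheSp (dearcL z hz)
      rwa [rotheSp_dearcL hz hfpf]
  have h3 : closure (OGX z) = closure (OGXess (dearcR z hz)) :=
    closure_OGX_eq hz hfpf (fun i j hij => cornerSum_dearcR_of_ess hz hfpf hij)
      fun ι hι h i j hij => le_on_rotheSp_of_dearcR hz hfpf hι h hij
  exact ⟨h1, h1.symm.trans h2, h1.symm.trans h3⟩
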